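/- **Setting.** Let $\mathcal X\subset\mathbb R^{d_x}$, $\mathcal U\subset\mathbb R^{d_u}$, $\mathcal Z=\mathcal X\times\mathcal U$, all with Euclidean norms. Let $k$ be a measurable kernel on $\mathcal Z$ with $\sup_{z\in\mathcal Z}k(z,z)<\infty$, with RKHS $\mathcal H_k$, let $\sigma>0$, and let $$\gamma_n=\sup_{z_1,\dots,z_n\in\mathcal Z}\tfrac12\log\det\bigl(I+\sigma^{-2}[k(z_a,z_b)]_{a,b\le n}\bigr).$$ Let $\Pi$ be a class of $L_\pi$-Lipschitz policies $\pi:\mathcal X\to\mathcal U$ and $\mathcal F$ a class of $L_f$-Lipschitz maps $\mathcal Z\to\mathbb R^{d_x}$ containing the unknown $f^*=(f_1^*,\dots,f_{d_x}^*)$, where $f^*_j\in\mathcal H_k$ and $\|f_j^*\|_k\le B$. Let $c:\mathcal Z\to\mathbb R$ be $L_c$-Lipschitz, $T>0$, $x_0\in\mathcal X$, and let $C(\pi,f)=\int_0^Tc(x,\pi(x))\,dt$ where $\dot x=f(x,\pi(x))$, $x(0)=x_0$ and $x(t)\in\mathcal X$ on $[0,T]$ (only pairs for which such a trajectory exists are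 admissible). Let $\pi^*\in\Pi$ minimize $C(\cdot,f^*)$ over $\Pi$. Let $\delta\in(0,1]$ and let $0\le\beta_0\le\beta_1\le\cdots$. **Algorithm (OCoRL).** In episode $n\ge1$, $(\pi_n,f_n)$ minimizes $C(\pi,f)$ over $\pi\in\Pi$, $f\in\mathcal M_{n-1}\cap\mathcal F$ (a minimizer is assumed to be found whenever an admissible pair exists; otherwise $\pi_n\in\Pi$ is arbitrary). The policy $\pi_n$ is run on $f^*$, giving the trajectory $x_n$ and $z_n(t)=(x_n(t),\pi_n(x_n(t)))$, and at $m_n$ times $t_{n,i}\in[0,T]$ one observes $\dot x_n(t_{n,i})+\varepsilon_{n,i}$ with i.i.d. noise $\varepsilon_{n,i}\sim\mathcal N(0,\sigma^2I)$; the measured pairs $z_n(t_{n,i})$ are determined by the noise of the earlier episodes. With $\mu_{n,j}$, $\sigma_{n,j}$ the posterior mean and standard deviation of a zero-mean Gaussian process with kernel $k$ and noise variance $\sigma^2$, given the $j$-th coordinates of all data of episodes $1,\dots,n$, $$\mathcal M_n=\{f:|\mu_{n,j}(z)-f_j(z)|\le\beta_n\sigma_{n,j}(z)\ \ \forall z\in\mathcal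 Z,\ j\le d_x\}.$$ The functions $\boldsymbol\sigma_n=(\sigma_{n,j})_j:\mathcal Z\to\mathbb R^{d_x}$ are assumed to be $L_\sigma$-Lipschitz. The model is called *well-calibrated* if $\Pr(f^*\in\mathcal M_n\ \forall n\ge0)\ge1-\delta$. The regret is $R_N=\sum_{n=1}^N(C(\pi_n,f^*)-C(\pi^*,f^*))$. **Measurement selection.** * *Oracle*: $m_n=1$ and $t_{n,1}\in\arg\max_{0\le t\le T}\|\boldsymbol\sigma_{n-1}(z_n(t))\|$. * *Equidistant*: $m_n=n$ and $t_{n,i}=\tau_n+(i-1)T/n$, $1\le i\le n$, with $\tau_n\in[0,T/n]$. * *Adaptive*: $m_n=\lceil T/\Delta_n\rceil$, where $\Delta_n>0$ solves $\Delta_n=1/(2\Gamma_n(\Delta_n))$ with $\Gamma_n(\Delta)=2\beta_nL_\sigma(1+L_\pi)e^{L_f(1+L_\pi)\Delta}$. On the $i$-th interval $[(i-1)\Delta_n,\min(i\Delta_n,T)]$, simulate $\dot{\hat x}=f_n(\hat x,\pi_n(\hat x))$ in $\mathcal X$ starting from $x_n((i-1)\Delta_n)$, and let $t_{n,i}$ be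 a time in the interval at which $\|\boldsymbol\sigma_{n-1}(\hat x,\pi_n(\hat x))\|$ is maximal. (If $\mathcal M_{n-1}\cap\mathcal F$ offers no admissible $f_n$, the $t_{n,i}$ are arbitrary.) **Theorem.** There are a constant $C_1$, depending only on $\mathcal X,\mathcal U,k,\sigma,L_c,L_\pi$, and a constant $C_2$, depending in addition only on $B,L_f,L_\sigma$, such that the following holds in the setting above. 1. The model is well-calibrated whenever $$\beta_n\ge B+\sqrt{2\bigl(\gamma_{m_1+\dots+m_n}+\log(d_x/\delta)\bigr)}\qquad\text{for all }n\ge0.$$ 2. Whenever the model is well-calibrated, each of the following holds with probability at least $1-\delta$, simultaneously for all $N$: $$R_N\le C_1\,\beta_NT^2e^{L_f(1+L_\pi)T}\sqrt{N\gamma_N}\qquad\text{for the oracle strategy }(m_n=1),$$ $$R_N\le C_2\,\beta_NT^2e^{L_f(1+L_\pi)T}\sqrt{N(\gamma_N+\log N)}\qquad\text{for the equidistant strategy }(m_n=n),$$ $$R_N\le C_1\,\beta_NT^2e^{L_f(1+L_\pi)T}\sqrt{N\gamma_N}\qquad\text{for the adaptive strategy}.$$ 3. For the adaptive strategy, $m_n=O(\beta_n)$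 as $n\to\infty$. -/

import Mathlib

open MeasureTheory ProbabilityTheory Set Filter
open scoped NNReal ENNReal

noncomputable section

namespace OCoRL

/-- `ℝ^d` with the Euclidean norm. -/
abbrev Vec (d : ℕ) : Type := EuclideanSpace ℝ (Fin d)

/-- The set `𝒵 = 𝒳 × 𝒰` of state-action pairs, with the metric induced by the Euclidean norm of
`ℝ^dx × ℝ^du`. -/
abbrev StateAction {dx du : ℕ} (X : Set (Vec dx)) (U : Set (Vec du)) : Type :=
  {z : WithLp 2 (Vec dx × Vec du) // z.fst ∈ X ∧ z.snd ∈ U}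

/-- The state-action pair `(x, π(x))`. -/
def withAction {dx du : ℕ} {X : Set (Vec dx)} {U : Set (Vec du)} (π : X → U) (x : X) :
    StateAction X U :=
  ⟨WithLp.toLp 2 ((x : Vec dx), (π x : Vec du)), x.2, (π x).2⟩

/-- `x : [0, T] → 𝒳` solves `x' = f(x, π(x))`, `x(0) = x₀`. Values of `x` outside `[0, T]` are
irrelevant. -/
def IsTrajectory {dx du : ℕ} {X : Set (Vec dx)} {U : Set (Vec du)}
    (f : StateAction X U → Vec dx) (π : X → U) (x₀ : X) (T : ℝ) (x : ℝ → X) : Prop :=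
  x 0 = x₀ ∧ ∀ t ∈ Icc 0 T,
    HasDerivWithinAt (fun s => (x s : Vec dx)) (f (withAction π (x t))) (Icc 0 T) t

/-- The cost `∫₀ᵀ c(x(t), π(x(t))) dt` of running the policy `π` along the trajectory `x`. -/
def runCost {dx du : ℕ} {X : Set (Vec dx)} {U : Set (Vec du)}
    (c : StateAction X U → ℝ) (T : ℝ) (π : X → U) (x : ℝ → X) : ℝ :=
  ∫ t in (0 : ℝ)..T, c (withAction π (x t))

/-- `π` is an optimal policy in the class `Pol` for the dynamics `f`, and `x` is its trajectory:
`C(π, f) ≤ C(π', f)` for all `π'` in `Pol`. -/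
def IsOptimalPolicy {dx du : ℕ} {X : Set (Vec dx)} {U : Set (Vec du)}
    (c : StateAction X U → ℝ) (T : ℝ) (x₀ : X) (f : StateAction X U → Vec dx)
    (Pol : Set (X → U)) (π : X → U) (x : ℝ → X) : Prop :=
  π ∈ Pol ∧ IsTrajectory f π x₀ T x ∧
    ∀ π' ∈ Pol, ∀ x', IsTrajectory f π' x₀ T x' → runCost c T π x ≤ runCost c T π' x'

section GaussianProcess

/-- The scalar kernel `k` of the reproducing kernel Hilbert space `H`. -/
def scalarKernel {Z : Type*} (H : Type*) [NormedAddCommGroup H] [InnerProductSpace ℝ H]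
    [CompleteSpace H] [RKHS ℝ H Z ℝ] (z w : Z) : ℝ :=
  RKHS.kernel H z w 1

/-- All coordinates of `f` belong to the ball of radius `B` of the RKHS `H`. -/
def InRKHSBall {Z : Type*} (H : Type*) [NormedAddCommGroup H] [InnerProductSpace ℝ H]
    [RKHS ℝ H Z ℝ] {d : ℕ} (B : ℝ) (f : Z → Vec d) : Prop :=
  ∀ j, ∃ h : H, ‖h‖ ≤ B ∧ ∀ z, f z j = h z

/-- The kernel matrix `K = [k(z_a, z_b)]`. -/
def kernelMatrix {Z ι : Type*} (k : Z → Z → ℝ) (p : ι → Z) : Matrix ι ι ℝ :=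
  Matrix.of fun a b => k (p a) (p b)

/-- The posterior mean `k(z)ᵀ (K + σ² I)⁻¹ y` of the zero-mean Gaussian process with kernel `k`,
given the observations `y` at the points `p`. -/
def gpMean {Z ι : Type*} [Fintype ι] [DecidableEq ι] (k : Z → Z → ℝ) (σ : ℝ) (p : ι → Z)
    (y : ι → ℝ) (z : Z) : ℝ :=
  (fun a => k (p a) z) ⬝ᵥ ((kernelMatrix k p + σ ^ 2 • (1 : Matrix ι ι ℝ))⁻¹.mulVec y)

/-- The posterior variance `k(z, z) - k(z)ᵀ (K + σ² I)⁻¹ k(z)`. -/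
def gpVar {Z ι : Type*} [Fintype ι] [DecidableEq ι] (k : Z → Z → ℝ) (σ : ℝ) (p : ι → Z)
    (z : Z) : ℝ :=
  k z z - (fun a => k (p a) z) ⬝ᵥ
    ((kernelMatrix k p + σ ^ 2 • (1 : Matrix ι ι ℝ))⁻¹.mulVec fun a => k (p a) z)

/-- The maximum information gain
`γ_n = sup { ½ log det(I + σ⁻² K_{AA}) : A consists of n points of Z }`
(points may be measured repeatedly). -/
def maxInfoGain {Z : Type*} (k : Z → Z → ℝ) (σ : ℝ) (n : ℕ) : ℝ :=
  ⨆ p : Fin n → Z, (1 / 2) * Real.log (1 + (σ ^ 2)⁻¹ • kernelMatrix k p).det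

end GaussianProcess

section Noise

/-- The noise vectors `ε_{n,i} = (noise n i j)_j` are i.i.d. with law `N(0, σ² I)`: equivalently,
all their coordinates are independent with law `N(0, σ²)`. -/
def IsGaussianNoise {Ω : Type*} [MeasurableSpace Ω] (P : Measure Ω) {d : ℕ} (σ : ℝ≥0)
    (noise : ℕ → ℕ → Fin d → Ω → ℝ) : Prop :=
  (∀ n i j, Measurable (noise n i j)) ∧
  (∀ n i j, P.map (noise n i j) = gaussianReal 0 (σ ^ 2)) ∧
  iIndepFun (fun q : ℕ × ℕ × Fin d => noise q.1 q.2.1 q.2.2) P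

/-- The information generated by the noise of the episodes `1, …, n`. -/
@[reducible] def history {Ω : Type*} {d : ℕ} (noise : ℕ → ℕ → Fin d → Ω → ℝ) (n : ℕ) : MeasurableSpace Ω :=
  ⨆ p ∈ Finset.Icc 1 n, ⨆ i : ℕ, ⨆ j : Fin d,
    MeasurableSpace.comap (noise p i j) inferInstance

end Noise

/-- The (random) quantities produced by episodes `n = 1, 2, …` of an episodic learning algorithm:
the deployed policy `π_n`, the dynamics `f_n` planned with, its trajectory, the trajectory of the
true system, the number `m_n` of measurements, and the measurement times `t_{n,i}`, where
`i = 0, …, m_n - 1`. Entries with `n = 0` or `i ≥ m_n` are never used. -/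
structure Episodes {dx du : ℕ} (X : Set (Vec dx)) (U : Set (Vec du)) (Ω : Type*) where
  policy : ℕ → Ω → X → U
  model : ℕ → Ω → StateAction X U → Vec dx
  planned : ℕ → Ω → ℝ → X
  traj : ℕ → Ω → ℝ → X
  count : ℕ → ℕ
  time : ℕ → ℕ → Ω → ℝ

namespace Episodes

/-- The state-action pair `z_n(t) = (x_n(t), π_n(x_n(t)))` on the true trajectory. -/
def stateAction {dx du : ℕ} {X : Set (Vec dx)} {U : Set (Vec du)} {Ω : Type*}
    (R : Episodes X U Ω) (n : ℕ) (ω : Ω) (t : ℝ) : StateAction X U :=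
  withAction (R.policy n ω) (R.traj n ω t)

/-- The measured state-action pair `z_n(t_{n,i})`. -/
def point {dx du : ℕ} {X : Set (Vec dx)} {U : Set (Vec du)} {Ω : Type*}
    (R : Episodes X U Ω) (n i : ℕ) (ω : Ω) : StateAction X U :=
  R.stateAction n ω (R.time n i ω)

/-- The index set of the measurements of the episodes `1, …, n`. -/
abbrev DataIndex {dx du : ℕ} {X : Set (Vec dx)} {U : Set (Vec du)} {Ω : Type*}
    (R : Episodes X U Ω) (n : ℕ) : Type :=
  Σ p : Fin n, Fin (R.count (p + 1))

/-- The measured pairs of the data set `𝒟_{1:n}`. -/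
def dataPoint {dx du : ℕ} {X : Set (Vec dx)} {U : Set (Vec du)} {Ω : Type*}
    (R : Episodes X U Ω) (n : ℕ) (ω : Ω) (a : R.DataIndex n) : StateAction X U :=
  R.point (a.1 + 1) a.2 ω

/-- The `j`-th coordinates of the observations `x_n'(t_{n,i}) + ε_{n,i}` of the data set `𝒟_{1:n}`,
where `x_n'(t) = f(z_n(t))` for the true dynamics `f`. -/
def dataObs {dx du : ℕ} {X : Set (Vec dx)} {U : Set (Vec du)} {Ω : Type*}
    (R : Episodes X U Ω) (f : StateAction X U → Vec dx) (noise : ℕ → ℕ → Fin dx → Ω → ℝ)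
    (n : ℕ) (ω : Ω) (j : Fin dx) (a : R.DataIndex n) : ℝ :=
  f (R.dataPoint n ω a) j + noise (a.1 + 1) a.2 j ω

/-- The number of measurements in the episodes `1, …, n`. -/
def totalCount {dx du : ℕ} {X : Set (Vec dx)} {U : Set (Vec du)} {Ω : Type*}
    (R : Episodes X U Ω) (n : ℕ) : ℕ :=
  ∑ p ∈ Finset.Icc 1 n, R.count p

/-- The vector `σ_n(z)` of posterior standard deviations after episode `n`. All coordinates are
modelled with the same kernel, so that its entries coincide. -/
def std {dx du : ℕ} {X : Set (Vec dx)} {U : Set (Vec du)} {Ω : Type*}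
    (R : Episodes X U Ω) (k : StateAction X U → StateAction X U → ℝ) (σ : ℝ)
    (n : ℕ) (ω : Ω) (z : StateAction X U) : Vec dx :=
  WithLp.toLp 2 fun _ => √(gpVar k σ (R.dataPoint n ω) z)

/-- The vector `μ_n(z)` of posterior means after episode `n`. -/
def mean {dx du : ℕ} {X : Set (Vec dx)} {U : Set (Vec du)} {Ω : Type*}
    (R : Episodes X U Ω) (k : StateAction X U → StateAction X U → ℝ) (σ : ℝ)
    (f : StateAction X U → Vec dx) (noise : ℕ → ℕ → Fin dx → Ω → ℝ)
    (n : ℕ) (ω : Ω) (z : StateAction X U) : Vec dx :=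
  WithLp.toLp 2 fun j => gpMean k σ (R.dataPoint n ω) (R.dataObs f noise n ω j) z

/-- The set `ℳ_n` of plausible dynamics: `|μ_{n,j}(z) - g_j(z)| ≤ β_n σ_{n,j}(z)` for all
`z` and `j`. -/
def confidenceSet {dx du : ℕ} {X : Set (Vec dx)} {U : Set (Vec du)} {Ω : Type*}
    (R : Episodes X U Ω) (k : StateAction X U → StateAction X U → ℝ) (σ : ℝ)
    (f : StateAction X U → Vec dx) (noise : ℕ → ℕ → Fin dx → Ω → ℝ) (β : ℕ → ℝ)
    (n : ℕ) (ω : Ω) : Set (StateAction X U → Vec dx) :=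
  {g | ∀ z j, |R.mean k σ f noise n ω z j - g z j| ≤ β n * R.std k σ n ω z j}

/-- The model is all-time well-calibrated: `f ∈ ⋂_n ℳ_n` with probability at least `1 - δ`. -/
def WellCalibrated {dx du : ℕ} {X : Set (Vec dx)} {U : Set (Vec du)} {Ω : Type*}
    [MeasurableSpace Ω] (P : Measure Ω)
    (R : Episodes X U Ω) (k : StateAction X U → StateAction X U → ℝ) (σ : ℝ)
    (f : StateAction X U → Vec dx) (noise : ℕ → ℕ → Fin dx → Ω → ℝ) (β : ℕ → ℝ)
    (δ : ℝ) : Prop :=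
  P {ω | ¬ ∀ n, f ∈ R.confidenceSet k σ f noise β n ω} ≤ ENNReal.ofReal δ

/-- The triple of a policy, plausible dynamics and the trajectory that they generate is admissible
for the optimistic optimal control problem that is solved after episode `n`. -/
def Plausible {dx du : ℕ} {X : Set (Vec dx)} {U : Set (Vec du)} {Ω : Type*}
    (R : Episodes X U Ω) (k : StateAction X U → StateAction X U → ℝ) (σ : ℝ)
    (f : StateAction X U → Vec dx) (noise : ℕ → ℕ → Fin dx → Ω → ℝ) (β : ℕ → ℝ)
    (T : ℝ) (x₀ : X) (Pol : Set (X → U)) (Dyn : Set (StateAction X U → Vec dx))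
    (n : ℕ) (ω : Ω) (π : X → U) (g : StateAction X U → Vec dx) (x : ℝ → X) : Prop :=
  π ∈ Pol ∧ g ∈ R.confidenceSet k σ f noise β n ω ∩ Dyn ∧ IsTrajectory g π x₀ T x

/-- `R` arises by running OCoRL on the system with true dynamics `f`, starting from `x₀`, with
policy class `Pol`, dynamics class `Dyn`, cost `c`, horizon `T` and the Gaussian process model with
kernel `k`, noise level `σ` and confidence widths `β`. -/
structure IsOCoRL {dx du : ℕ} {X : Set (Vec dx)} {U : Set (Vec du)} {Ω : Type*}
    (R : Episodes X U Ω) (k : StateAction X U → StateAction X U → ℝ) (σ : ℝ)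
    (f : StateAction X U → Vec dx) (noise : ℕ → ℕ → Fin dx → Ω → ℝ) (β : ℕ → ℝ)
    (c : StateAction X U → ℝ) (T : ℝ) (x₀ : X) (Pol : Set (X → U))
    (Dyn : Set (StateAction X U → Vec dx)) : Prop where
  policy_mem : ∀ n ω, R.policy (n + 1) ω ∈ Pol
  /-- The policy of every episode is deployed on the true system. -/
  isTrajectory : ∀ n ω, IsTrajectory f (R.policy (n + 1) ω) x₀ T (R.traj (n + 1) ω)
  time_mem : ∀ n ω, ∀ i < R.count (n + 1), R.time (n + 1) i ω ∈ Icc 0 T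
  /-- The decisions of an episode depend only on what was observed in the earlier episodes. -/
  measurable_point : ∀ n, ∀ i < R.count (n + 1), Measurable[history noise n] (R.point (n + 1) i)
  /-- `(π_{n+1}, f_{n+1})` minimizes `C(π, g)` over `π ∈ Pol` and `g ∈ ℳ_n ∩ Dyn`, unless no
  admissible pair exists. -/
  optimistic : ∀ n ω,
    (∃ π g x, R.Plausible k σ f noise β T x₀ Pol Dyn n ω π g x) →
      R.Plausible k σ f noise β T x₀ Pol Dyn n ω
        (R.policy (n + 1) ω) (R.model (n + 1) ω) (R.planned (n + 1) ω) ∧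
      ∀ π g x, R.Plausible k σ f noise β T x₀ Pol Dyn n ω π g x →
        runCost c T (R.policy (n + 1) ω) (R.planned (n + 1) ω) ≤ runCost c T π x

/-- The cumulative regret `R_N = ∑_{n=1}^N (C(π_n, f) - C(π*, f))`, where `xstar` is the trajectory
of the true system `f` under `πstar`. -/
def regret {dx du : ℕ} {X : Set (Vec dx)} {U : Set (Vec du)} {Ω : Type*}
    (R : Episodes X U Ω) (c : StateAction X U → ℝ) (T : ℝ) (πstar : X → U) (xstar : ℝ → X)
    (N : ℕ) (ω : Ω) : ℝ :=
  ∑ n ∈ Finset.Icc 1 N, (runCost c T (R.policy n ω) (R.traj n ω) - runCost c T πstar xstar)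

/-- Oracle measurement selection: one measurement per episode, at a time of maximal uncertainty on
the true trajectory. -/
def IsOracle {dx du : ℕ} {X : Set (Vec dx)} {U : Set (Vec du)} {Ω : Type*}
    (R : Episodes X U Ω) (k : StateAction X U → StateAction X U → ℝ) (σ : ℝ) (T : ℝ) : Prop :=
  ∀ n, R.count (n + 1) = 1 ∧
    ∀ ω, IsMaxOn (fun t => ‖R.std k σ n ω (R.stateAction (n + 1) ω t)‖) (Icc 0 T)
      (R.time (n + 1) 0 ω)

/-- Equidistant measurement selection with `m_n = n`: in episode `n` there are `n` measurements with
spacing `T / n`, the first of them at a time `τ_n ∈ [0, T / n]`. -/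
def IsEquidistant {dx du : ℕ} {X : Set (Vec dx)} {U : Set (Vec du)} {Ω : Type*}
    (R : Episodes X U Ω) (T : ℝ) : Prop :=
  ∃ τ : ℕ → ℝ, ∀ n : ℕ, R.count (n + 1) = n + 1 ∧
    τ (n + 1) ∈ Icc 0 (T / ((n : ℝ) + 1)) ∧
    ∀ i < n + 1, ∀ ω, R.time (n + 1) i ω = τ (n + 1) + i * (T / ((n : ℝ) + 1))

/-- `Γ_n(Δ) = 2 β_n L_σ (1 + L_π) exp(L_f (1 + L_π) Δ)`, with `b = β_n`. -/
def Gam (Lf Lπ Lσ : ℝ≥0) (b Δ : ℝ) : ℝ :=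
  2 * b * Lσ * (1 + Lπ) * Real.exp (Lf * (1 + Lπ) * Δ)

/-- Adaptive measurement selection. In episode `n` the horizon is split into `m_n = ⌈T / Δ_n⌉`
intervals of length `Δ_n` (the last one is cut off at `T`), where `Δ_n = 1 / (2 Γ_n(Δ_n))`. At the
beginning of each interval the planned dynamics `f_n` are simulated under `π_n` from the current
true state, and the measurement is taken at a time where the uncertainty on this hallucinated
trajectory is largest. (There is something to simulate only if plausible dynamics exist.) -/
def IsAdaptive {dx du : ℕ} {X : Set (Vec dx)} {U : Set (Vec du)} {Ω : Type*}
    (R : Episodes X U Ω) (k : StateAction X U → StateAction X U → ℝ) (σ : ℝ)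
    (f : StateAction X U → Vec dx) (noise : ℕ → ℕ → Fin dx → Ω → ℝ) (β : ℕ → ℝ)
    (T : ℝ) (Dyn : Set (StateAction X U → Vec dx)) (Lf Lπ Lσ : ℝ≥0) : Prop :=
  ∃ Δ : ℕ → ℝ, ∀ n,
    0 < Δ (n + 1) ∧
    Δ (n + 1) * (2 * Gam Lf Lπ Lσ (β (n + 1)) (Δ (n + 1))) = 1 ∧
    R.count (n + 1) = ⌈T / Δ (n + 1)⌉₊ ∧
    ∀ ω, R.model (n + 1) ω ∈ R.confidenceSet k σ f noise β n ω ∩ Dyn →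
      ∀ i < R.count (n + 1), ∃ x : ℝ → X, ∃ s : ℝ,
        IsTrajectory (R.model (n + 1) ω) (R.policy (n + 1) ω)
          (R.traj (n + 1) ω (i * Δ (n + 1))) (min (Δ (n + 1)) (T - i * Δ (n + 1))) x ∧
        s ∈ Icc 0 (min (Δ (n + 1)) (T - i * Δ (n + 1))) ∧
        IsMaxOn (fun t => ‖R.std k σ n ω (withAction (R.policy (n + 1) ω) (x t))‖)
          (Icc 0 (min (Δ (n + 1)) (T - i * Δ (n + 1)))) s ∧
        R.time (n + 1) i ω = i * Δ (n + 1) + s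

end Episodes

end OCoRL

end

open OCoRL

/-! Write k(z, w) = ⟨φ z, φ w⟩ for a feature map φ. The posterior variance is the minimum over
weights w of ‖φ z − ∑ w_a φ(p_a)‖² + σ²|w|² (`norm_sub_sq_add_eq`). Hence additional data never
increase it, and its square root controls the error of the posterior mean up to the factor ‖h‖ + √Q,
where Q = ε·ε/σ² − ε·(K + σ²I)⁻¹ε measures the noise vector ε (`abs_gpMean_sub_le`).

Calibration: exp(Q/2 − information gain) is the likelihood ratio of N(0, K + σ²I) against N(0, σ²I),
evaluated at the noise. The measured points are determined by earlier noise, so a further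
measurement multiplies it by a predictive density over the noise density, a factor whose mean under
the noise is one. It is a nonnegative martingale started at 1, and Ville's inequality at level dx/δ
for each coordinate bounds Q for all episodes at once (`wellCalibrated`).

Regret: on the event that f is always plausible, the argument is deterministic. By optimism the
planned cost is at most the optimal cost, so an episode loses at most the cost difference of one
policy under f and under f_n. These dynamics differ by at most 2β‖σ‖ along the true trajectory, and
Grönwall's inequality converts this into a difference of costs (`IsOCoRL.regret_le`). Each
measurement rule supplies one measured point per episode whose uncertainty dominates the whole
trajectory: with factor 1 for the oracle, factor 3 for the adaptive rule, and an additive O(1/n) for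
the equidistant one, whose sum is the logarithm in the bound. Keeping only that point of each
episode, the chain rule for log det bounds the sum of the squared uncertainties by a multiple of
γ_N, and Cauchy–Schwarz gives √(N γ_N).

Measurement count: the equation for Δ_n keeps Δ_n bounded, so T/Δ_n = 2TΓ_n(Δ_n) grows at most
linearly in β_n. -/

noncomputable section

namespace OCoRL

open Matrix

/-! ### Regularized kernel systems, posterior variance and Schur complements -/

section LinearAlgebra

variable {Z ι κ : Type*} [Fintype ι] [DecidableEq ι] [Fintype κ] [DecidableEq κ]
  {H : Type*} [NormedAddCommGroup H] [InnerProductSpace ℝ H]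
  {k : Z → Z → ℝ} {φ : Z → H} {σ : ℝ}

/-- The regularized kernel matrix `K + σ² I`. -/
def regMatrix {Z ι : Type*} [DecidableEq ι] (k : Z → Z → ℝ) (σ : ℝ) (p : ι → Z) :
    Matrix ι ι ℝ :=
  kernelMatrix k p + σ ^ 2 • (1 : Matrix ι ι ℝ)

/-- The solution `(K + σ² I)⁻¹ y` of the regularized kernel system. -/
def regSolve {Z ι : Type*} [Fintype ι] [DecidableEq ι] (k : Z → Z → ℝ) (σ : ℝ) (p : ι → Z)
    (y : ι → ℝ) : ι → ℝ :=
  (regMatrix k σ p)⁻¹ *ᵥ y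

/-- The information gain `½ log det (I + σ⁻² K)`. -/
def infoGain {Z ι : Type*} [Fintype ι] [DecidableEq ι] (k : Z → Z → ℝ) (σ : ℝ) (p : ι → Z) : ℝ :=
  (1 / 2) * Real.log (1 + (σ ^ 2)⁻¹ • kernelMatrix k p).det

omit [Fintype ι] [DecidableEq ι] in
theorem kernelMatrix_eq_gram (hk : ∀ z w, k z w = inner ℝ (φ z) (φ w)) (p : ι → Z) :
    kernelMatrix k p = Matrix.gram ℝ (φ ∘ p) := by
  ext a b
  simp [kernelMatrix, Matrix.gram, hk]

theorem regMatrix_posDef (hk : ∀ z w, k z w = inner ℝ (φ z) (φ w)) (hσ : 0 < σ) (p : ι → Z) :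
    (regMatrix k σ p).PosDef := by
  have h1 : (σ ^ 2 • (1 : Matrix ι ι ℝ)).PosDef := Matrix.PosDef.one.smul (by positivity)
  rw [regMatrix, kernelMatrix_eq_gram hk]
  exact h1.posSemidef_add (Matrix.posSemidef_gram ℝ _)

theorem regMatrix_mulVec_regSolve (hk : ∀ z w, k z w = inner ℝ (φ z) (φ w)) (hσ : 0 < σ)
    (p : ι → Z) (y : ι → ℝ) : regMatrix k σ p *ᵥ regSolve k σ p y = y := by
  have := (regMatrix_posDef hk hσ p).isUnit
  rw [regSolve, Matrix.mulVec_mulVec, Matrix.mul_nonsing_inv _ ((Matrix.isUnit_iff_isUnit_det _).1 this),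
    Matrix.one_mulVec]

theorem regSolve_eq (hk : ∀ z w, k z w = inner ℝ (φ z) (φ w)) (hσ : 0 < σ)
    (p : ι → Z) {x y : ι → ℝ} (h : regMatrix k σ p *ᵥ x = y) : regSolve k σ p y = x := by
  have := (regMatrix_posDef hk hσ p).isUnit
  rw [regSolve, ← h, Matrix.mulVec_mulVec,
    Matrix.nonsing_inv_mul _ ((Matrix.isUnit_iff_isUnit_det _).1 this), Matrix.one_mulVec]

theorem regMatrix_mulVec_apply (p : ι → Z) (x : ι → ℝ) (a : ι) :
    (regMatrix k σ p *ᵥ x) a = ∑ b, k (p a) (p b) * x b + σ ^ 2 * x a := by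
  rw [regMatrix, Matrix.add_mulVec, Matrix.smul_mulVec, Matrix.one_mulVec]
  rfl

/-- K is a Gram matrix, so quadratic forms in K + σ²I become Hilbert space geometry; the later
estimates avoid matrix inequalities this way. -/
theorem dotProduct_regMatrix_mulVec (hk : ∀ z w, k z w = inner ℝ (φ z) (φ w)) (p : ι → Z)
    (x y : ι → ℝ) : x ⬝ᵥ regMatrix k σ p *ᵥ y =
      inner ℝ (∑ a, x a • φ (p a)) (∑ a, y a • φ (p a)) + σ ^ 2 * (x ⬝ᵥ y) := by
  simp only [dotProduct, regMatrix_mulVec_apply, mul_add, Finset.sum_add_distrib, sum_inner,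
    inner_sum, inner_smul_left, inner_smul_right, Finset.mul_sum, hk]
  congr 1
  · rw [Finset.sum_comm]
    refine Finset.sum_congr rfl fun a _ => Finset.sum_congr rfl fun b _ => ?_
    simp only [conj_trivial]
    ring
  · refine Finset.sum_congr rfl fun a _ => ?_
    ring

omit [DecidableEq ι] in
theorem inner_sum_smul_eq_dotProduct (hk : ∀ z w, k z w = inner ℝ (φ z) (φ w)) (p : ι → Z)
    (x : ι → ℝ) (z : Z) : inner ℝ (φ z) (∑ a, x a • φ (p a)) = (fun a => k (p a) z) ⬝ᵥ x := by
  simp only [dotProduct, inner_sum, inner_smul_right, hk]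
  refine Finset.sum_congr rfl fun a _ => ?_
  rw [real_inner_comm, mul_comm]

theorem dotProduct_regSolve_comm (hk : ∀ z w, k z w = inner ℝ (φ z) (φ w)) (hσ : 0 < σ)
    (p : ι → Z) (x y : ι → ℝ) : x ⬝ᵥ regSolve k σ p y = regSolve k σ p x ⬝ᵥ y := by
  conv_lhs => rw [← regMatrix_mulVec_regSolve hk hσ p x]
  conv_rhs => rw [← regMatrix_mulVec_regSolve hk hσ p y]
  rw [dotProduct_comm, dotProduct_regMatrix_mulVec hk, dotProduct_regMatrix_mulVec hk,
    real_inner_comm, dotProduct_comm]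

theorem gpVar_eq (p : ι → Z) (z : Z) :
    gpVar k σ p z = k z z - (fun a => k (p a) z) ⬝ᵥ regSolve k σ p (fun a => k (p a) z) := rfl

theorem gpMean_eq (p : ι → Z) (y : ι → ℝ) (z : Z) :
    gpMean k σ p y z = (fun a => k (p a) z) ⬝ᵥ regSolve k σ p y := rfl

/-- Completing the square: the posterior variance is the minimum of a regularized least squares
problem. -/
theorem norm_sub_sq_add_eq (hk : ∀ z w, k z w = inner ℝ (φ z) (φ w)) (hσ : 0 < σ) (p : ι → Z)
    (z : Z) (w : ι → ℝ) :
    ‖φ z - ∑ a, w a • φ (p a)‖ ^ 2 + σ ^ 2 * (w ⬝ᵥ w) = gpVar k σ p z +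
      (‖∑ a, (w - regSolve k σ p fun a => k (p a) z) a • φ (p a)‖ ^ 2 +
        σ ^ 2 * ((w - regSolve k σ p fun a => k (p a) z) ⬝ᵥ
          (w - regSolve k σ p fun a => k (p a) z))) := by
  set v := regSolve k σ p fun a => k (p a) z with hv
  have hAv : regMatrix k σ p *ᵥ v = fun a => k (p a) z := regMatrix_mulVec_regSolve hk hσ p _
  have h1 := dotProduct_regMatrix_mulVec (σ := σ) hk p w v
  have h2 := dotProduct_regMatrix_mulVec (σ := σ) hk p v v
  rw [hAv] at h1 h2
  have h3 := inner_sum_smul_eq_dotProduct hk p w z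
  have h5 : ∑ a, (w - v) a • φ (p a) = ∑ a, w a • φ (p a) - ∑ a, v a • φ (p a) := by
    simp [sub_smul, Finset.sum_sub_distrib]
  rw [gpVar_eq, ← hv, h5, norm_sub_sq_real, norm_sub_sq_real, h3, hk z z,
    real_inner_self_eq_norm_sq, dotProduct_comm _ v, h2, real_inner_self_eq_norm_sq,
    dotProduct_comm _ w, h1]
  simp only [sub_dotProduct, dotProduct_sub, dotProduct_comm v w]
  ring

theorem gpVar_le (hk : ∀ z w, k z w = inner ℝ (φ z) (φ w)) (hσ : 0 < σ) (p : ι → Z)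
    (z : Z) (w : ι → ℝ) :
    gpVar k σ p z ≤ ‖φ z - ∑ a, w a • φ (p a)‖ ^ 2 + σ ^ 2 * (w ⬝ᵥ w) := by
  rw [norm_sub_sq_add_eq hk hσ]
  have : ∀ x : ι → ℝ, 0 ≤ x ⬝ᵥ x := fun x => Finset.sum_nonneg fun a _ => mul_self_nonneg (x a)
  have := this (w - regSolve k σ p fun a => k (p a) z)
  have : 0 ≤ ‖∑ a, (w - regSolve k σ p fun a => k (p a) z) a • φ (p a)‖ ^ 2 +
        σ ^ 2 * ((w - regSolve k σ p fun a => k (p a) z) ⬝ᵥ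
          (w - regSolve k σ p fun a => k (p a) z)) := by positivity
  linarith

theorem gpVar_eq_norm (hk : ∀ z w, k z w = inner ℝ (φ z) (φ w)) (hσ : 0 < σ) (p : ι → Z)
    (z : Z) :
    gpVar k σ p z = ‖φ z - ∑ a, (regSolve k σ p fun a => k (p a) z) a • φ (p a)‖ ^ 2 +
      σ ^ 2 * ((regSolve k σ p fun a => k (p a) z) ⬝ᵥ (regSolve k σ p fun a => k (p a) z)) := by
  rw [norm_sub_sq_add_eq hk hσ]
  simp

theorem gpVar_nonneg (hk : ∀ z w, k z w = inner ℝ (φ z) (φ w)) (hσ : 0 < σ) (p : ι → Z)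
    (z : Z) : 0 ≤ gpVar k σ p z := by
  rw [gpVar_eq_norm hk hσ]
  have : ∀ x : ι → ℝ, 0 ≤ x ⬝ᵥ x := fun x => Finset.sum_nonneg fun a _ => mul_self_nonneg (x a)
  have := this (regSolve k σ p fun a => k (p a) z)
  positivity

theorem gpVar_le_kernel (hk : ∀ z w, k z w = inner ℝ (φ z) (φ w)) (hσ : 0 < σ) (p : ι → Z)
    (z : Z) : gpVar k σ p z ≤ k z z := by
  refine (gpVar_le hk hσ p z 0).trans ?_
  simp [hk]

omit [DecidableEq ι] [DecidableEq κ] in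
theorem sum_eq_sum_comp_of_injective {M : Type*} [AddCommMonoid M] {e : κ → ι}
    (he : Function.Injective e) (g : ι → M) (hg : ∀ a, a ∉ Set.range e → g a = 0) :
    ∑ a, g a = ∑ b, g (e b) := by
  classical
  rw [← Finset.sum_image (s := Finset.univ) (g := e) (f := g) he.injOn]
  refine (Finset.sum_subset (Finset.subset_univ _) fun a _ ha => hg a ?_).symm
  simpa using ha

/-- More data reduces the posterior variance. -/
theorem gpVar_le_gpVar_comp (hk : ∀ z w, k z w = inner ℝ (φ z) (φ w)) (hσ : 0 < σ) (p : ι → Z)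
    {e : κ → ι} (he : Function.Injective e) (z : Z) :
    gpVar k σ p z ≤ gpVar k σ (p ∘ e) z := by
  rw [gpVar_eq_norm hk hσ (p ∘ e)]
  set v := regSolve k σ (p ∘ e) fun a => k ((p ∘ e) a) z
  -- The optimal weights for the smaller data set, padded by zeros, compete in the larger least
  -- squares problem at the same value.
  refine (gpVar_le hk hσ p z (Function.extend e v 0)).trans_eq ?_
  have hz : ∀ a, a ∉ Set.range e → Function.extend e v 0 a = 0 := fun a ha => by
    rw [Function.extend_apply' _ _ _ (by simpa using ha)]; rfl
  rw [sum_eq_sum_comp_of_injective he (fun a => Function.extend e v 0 a • φ (p a)) fun a ha => by rw [hz a ha, zero_smul]]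
  simp only [dotProduct]
  rw [sum_eq_sum_comp_of_injective he (fun a => Function.extend e v 0 a * Function.extend e v 0 a) fun a ha => by
      rw [hz a ha, zero_mul]]
  simp [he.extend_apply]

omit [Fintype ι] [Fintype κ] in
theorem regMatrix_comp (p : κ → Z) (e : ι ≃ κ) :
    regMatrix k σ (p ∘ e) = (regMatrix k σ p).submatrix e e := by
  ext a b
  simp [regMatrix, kernelMatrix, Matrix.one_apply]

theorem regSolve_comp (p : κ → Z) (y : κ → ℝ) (e : ι ≃ κ) :
    regSolve k σ (p ∘ e) (y ∘ e) = regSolve k σ p y ∘ e := by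
  rw [regSolve, regMatrix_comp, Matrix.inv_submatrix_equiv, Matrix.submatrix_mulVec_equiv]
  simp [regSolve, Function.comp_assoc]

theorem infoGain_comp (p : κ → Z) (e : ι ≃ κ) : infoGain k σ (p ∘ e) = infoGain k σ p := by
  have : 1 + (σ ^ 2)⁻¹ • kernelMatrix k (p ∘ e) =
      (1 + (σ ^ 2)⁻¹ • kernelMatrix k p).submatrix e e := by
    ext a b
    simp [kernelMatrix, Matrix.one_apply]
  rw [infoGain, this, Matrix.det_submatrix_equiv_self, infoGain]

/-- The Schur complement recursion for the regularized quadratic form. -/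
theorem dotProduct_regSolve_sumElim (hk : ∀ z w, k z w = inner ℝ (φ z) (φ w)) (hσ : 0 < σ)
    (p : ι → Z) (z : Z) (y : ι → ℝ) (t : ℝ) :
    Sum.elim y (fun _ : Fin 1 => t) ⬝ᵥ
        regSolve k σ (Sum.elim p fun _ : Fin 1 => z) (Sum.elim y fun _ => t) =
      y ⬝ᵥ regSolve k σ p y + (t - gpMean k σ p y z) ^ 2 / (gpVar k σ p z + σ ^ 2) := by
  have hs : 0 < gpVar k σ p z + σ ^ 2 := by
    have := gpVar_nonneg hk hσ p z
    positivity
  -- Block elimination: the last coordinate of the enlarged solution is the innovation divided by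
  -- the Schur complement `gpVar + σ ^ 2`.
  set s := (t - gpMean k σ p y z) / (gpVar k σ p z + σ ^ 2) with hs'
  set v := regSolve k σ p fun a => k (p a) z with hv
  have hst : s * (gpVar k σ p z + σ ^ 2) = t - gpMean k σ p y z := by
    rw [hs']; field_simp
  have hsol : regSolve k σ (Sum.elim p fun _ : Fin 1 => z) (Sum.elim y fun _ => t) =
      Sum.elim (regSolve k σ p y - s • v) (fun _ => s) := by
    refine regSolve_eq hk hσ _ ?_
    ext a
    rw [regMatrix_mulVec_apply, Fintype.sum_sum_type]
    rcases a with a | a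
    · have h1 := congrFun (regMatrix_mulVec_regSolve hk hσ p y) a
      have h2 := congrFun (regMatrix_mulVec_regSolve hk hσ p fun a => k (p a) z) a
      rw [regMatrix_mulVec_apply] at h1 h2
      simp only [Sum.elim_inl, Sum.elim_inr, Pi.sub_apply, Pi.smul_apply, smul_eq_mul,
        Finset.univ_unique, Finset.sum_singleton, mul_sub, Finset.sum_sub_distrib]
      rw [← hv] at h2
      have h3 : ∑ b, k (p a) (p b) * (s * v b) = s * ∑ b, k (p a) (p b) * v b := by
        rw [Finset.mul_sum]
        exact Finset.sum_congr rfl fun b _ => by ring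
      rw [h3]
      linear_combination h1 - s * h2
    · have h1 : ∑ b, k z (p b) * regSolve k σ p y b = gpMean k σ p y z := by
        simp only [gpMean_eq, dotProduct, hk, real_inner_comm]
      have h2 : ∑ b, k z (p b) * v b = k z z - gpVar k σ p z := by
        rw [gpVar_eq, ← hv, sub_sub_cancel]
        simp only [dotProduct, hk, real_inner_comm]
      simp only [Sum.elim_inl, Sum.elim_inr, Pi.sub_apply, Pi.smul_apply, smul_eq_mul,
        Finset.univ_unique, Finset.sum_singleton, mul_sub, Finset.sum_sub_distrib]
      have h3 : ∑ b, k z (p b) * (s * v b) = s * ∑ b, k z (p b) * v b := by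
        rw [Finset.mul_sum]
        exact Finset.sum_congr rfl fun b _ => by ring
      rw [h3, h1, h2]
      linear_combination hst
  rw [hsol]
  have h1 : y ⬝ᵥ v = gpMean k σ p y z := by
    rw [hv, dotProduct_regSolve_comm hk hσ, dotProduct_comm]; rfl
  have h2 : (t - gpMean k σ p y z) ^ 2 / (gpVar k σ p z + σ ^ 2) =
      s * (t - gpMean k σ p y z) := by
    rw [hs']; ring
  rw [h2]
  simp only [dotProduct, Fintype.sum_sum_type, Sum.elim_inl, Sum.elim_inr, Pi.sub_apply,
    Pi.smul_apply, smul_eq_mul, Finset.univ_unique, Finset.sum_singleton, mul_sub,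
    Finset.sum_sub_distrib] at h1 ⊢
  have h3 : ∑ b, y b * (s * v b) = s * ∑ b, y b * v b := by
    rw [Finset.mul_sum]
    exact Finset.sum_congr rfl fun b _ => by ring
  rw [h3, h1]
  ring

omit [Fintype ι] in
theorem one_add_smul_kernelMatrix (hσ : 0 < σ) (p : ι → Z) :
    1 + (σ ^ 2)⁻¹ • kernelMatrix k p = (σ ^ 2)⁻¹ • regMatrix k σ p := by
  rw [regMatrix, smul_add, smul_smul, inv_mul_cancel₀ (by positivity), one_smul, add_comm]

/-- The Schur complement of the old block is the predictive variance of the new observation. -/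
theorem det_regMatrix_sumElim (hk : ∀ z w, k z w = inner ℝ (φ z) (φ w)) (hσ : 0 < σ)
    (p : ι → Z) (z : Z) :
    (regMatrix k σ (Sum.elim p fun _ : Fin 1 => z)).det =
      (regMatrix k σ p).det * (gpVar k σ p z + σ ^ 2) := by
  have hblock : regMatrix k σ (Sum.elim p fun _ : Fin 1 => z) =
      Matrix.fromBlocks (regMatrix k σ p) (Matrix.of fun a _ => k (p a) z)
        (Matrix.of fun _ a => k (p a) z) (Matrix.of fun _ _ => k z z + σ ^ 2) := by
    ext (a | a) (b | b)
    · simp [regMatrix, kernelMatrix, Matrix.one_apply]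
    · simp [regMatrix, kernelMatrix]
    · simp [regMatrix, kernelMatrix, hk, real_inner_comm]
    · simp [regMatrix, kernelMatrix, Subsingleton.elim a b]
  have : Invertible (regMatrix k σ p) := (regMatrix_posDef hk hσ p).isUnit.invertible
  rw [hblock, Matrix.det_fromBlocks₁₁, Matrix.det_fin_one, Matrix.invOf_eq_nonsing_inv]
  congr 1
  have : ((Matrix.of fun (_ : Fin 1) a => k (p a) z) * (regMatrix k σ p)⁻¹ *
      Matrix.of fun a (_ : Fin 1) => k (p a) z) 0 0 =
      (fun a => k (p a) z) ⬝ᵥ regSolve k σ p (fun a => k (p a) z) := by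
    rw [Matrix.mul_assoc, Matrix.mul_apply]
    rfl
  rw [Matrix.sub_apply, this, gpVar_eq]
  simp only [Matrix.of_apply]
  ring

/-- Chain rule for mutual information: a new point contributes the information of one Gaussian
measurement with signal variance `gpVar` and noise variance σ². -/
theorem infoGain_sumElim (hk : ∀ z w, k z w = inner ℝ (φ z) (φ w)) (hσ : 0 < σ)
    (p : ι → Z) (z : Z) :
    infoGain k σ (Sum.elim p fun _ : Fin 1 => z) =
      infoGain k σ p + (1 / 2) * Real.log (1 + gpVar k σ p z / σ ^ 2) := by
  have hpos := (regMatrix_posDef hk hσ p).det_pos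
  have hs := gpVar_nonneg hk hσ p z
  have hσ2 : 0 < σ ^ 2 := by positivity
  rw [infoGain, infoGain, one_add_smul_kernelMatrix hσ, one_add_smul_kernelMatrix hσ,
    Matrix.det_smul, Matrix.det_smul, det_regMatrix_sumElim hk hσ, ← mul_add,
    ← Real.log_mul (by positivity) (by positivity)]
  congr 2
  simp only [Fintype.card_sum, Fintype.card_fin, pow_succ]
  field_simp
  ring

end LinearAlgebra

/-! ### Information gain and the error of the posterior mean -/

section InfoGain

variable {Z ι : Type*} [Fintype ι] [DecidableEq ι]
  {H : Type*} [NormedAddCommGroup H] [InnerProductSpace ℝ H]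
  {k : Z → Z → ℝ} {φ : Z → H} {σ κ : ℝ}

theorem infoGain_snoc (hk : ∀ z w, k z w = inner ℝ (φ z) (φ w)) (hσ : 0 < σ) {n : ℕ}
    (q : Fin (n + 1) → Z) :
    infoGain k σ q = infoGain k σ (fun i : Fin n => q i.castSucc) +
      (1 / 2) * Real.log
        (1 + gpVar k σ (fun i : Fin n => q i.castSucc) (q (Fin.last n)) / σ ^ 2) := by
  rw [← infoGain_comp q (finSumFinEquiv : Fin n ⊕ Fin 1 ≃ Fin (n + 1)),
    ← infoGain_sumElim hk hσ]
  congr 1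
  ext (a | a)
  · rfl
  · simp only [Function.comp_apply, finSumFinEquiv_apply_right, Sum.elim_inr]
    congr 1
    ext
    simp

theorem infoGain_eq_zero_of_isEmpty [IsEmpty ι] (p : ι → Z) : infoGain k σ p = 0 := by
  simp [infoGain]

theorem infoGain_eq_sum (hk : ∀ z w, k z w = inner ℝ (φ z) (φ w)) (hσ : 0 < σ) (q : ℕ → Z)
    (N : ℕ) : infoGain k σ (fun i : Fin N => q i) = ∑ n ∈ Finset.range N,
      (1 / 2) * Real.log (1 + gpVar k σ (fun i : Fin n => q i) (q n) / σ ^ 2) := by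
  induction N with
  | zero => simp [infoGain_eq_zero_of_isEmpty]
  | succ n ih => rw [infoGain_snoc hk hσ, Finset.sum_range_succ, ← ih]; rfl

theorem infoGain_le (hk : ∀ z w, k z w = inner ℝ (φ z) (φ w)) (hσ : 0 < σ)
    (hκ : ∀ z, k z z ≤ κ) {n : ℕ} (q : Fin n → Z) :
    infoGain k σ q ≤ n * ((1 / 2) * Real.log (1 + κ / σ ^ 2)) := by
  induction n with
  | zero => simp [infoGain_eq_zero_of_isEmpty]
  | succ n ih =>
    rw [infoGain_snoc hk hσ]
    push_cast
    rw [add_mul, one_mul]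
    have h0 := gpVar_nonneg hk hσ (fun i : Fin n => q i.castSucc) (q (Fin.last n))
    have h1 := (gpVar_le_kernel hk hσ (fun i : Fin n => q i.castSucc) (q (Fin.last n))).trans
      (hκ _)
    gcongr
    exact ih _

/-- Without boundedness the real supremum in `maxInfoGain` would take the default value 0 and would
bound nothing. -/
theorem bddAbove_infoGain (hk : ∀ z w, k z w = inner ℝ (φ z) (φ w)) (hσ : 0 < σ)
    (hκ : ∀ z, k z z ≤ κ) (n : ℕ) :
    BddAbove (Set.range fun p : Fin n → Z => infoGain k σ p) := by
  refine ⟨n * ((1 / 2) * Real.log (1 + κ / σ ^ 2)), ?_⟩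
  rintro _ ⟨q, rfl⟩
  exact infoGain_le hk hσ hκ q

theorem infoGain_le_maxInfoGain (hk : ∀ z w, k z w = inner ℝ (φ z) (φ w)) (hσ : 0 < σ)
    (hκ : ∀ z, k z z ≤ κ) {n : ℕ} (hn : Fintype.card ι = n) (p : ι → Z) :
    infoGain k σ p ≤ maxInfoGain k σ n := by
  rw [← infoGain_comp p (Fintype.equivFinOfCardEq hn).symm]
  exact le_ciSup (bddAbove_infoGain hk hσ hκ n) (p ∘ (Fintype.equivFinOfCardEq hn).symm)

/-- From log(1 + u) ≥ u/(1 + u) with u = v/σ², and v ≤ κ in the resulting denominator σ² + v. It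
trades a variance for an information increment. -/
theorem gpVar_le_mul_log (hk : ∀ z w, k z w = inner ℝ (φ z) (φ w)) (hσ : 0 < σ)
    (hκ : ∀ z, k z z ≤ κ) (p : ι → Z) (z : Z) :
    gpVar k σ p z ≤ (σ ^ 2 + κ) * Real.log (1 + gpVar k σ p z / σ ^ 2) := by
  have h0 := gpVar_nonneg hk hσ p z
  have h1 := (gpVar_le_kernel hk hσ p z).trans (hκ z)
  set v := gpVar k σ p z
  have hσ2 : 0 < σ ^ 2 := by positivity
  have h2 := Real.one_sub_inv_le_log_of_pos (x := 1 + v / σ ^ 2) (by positivity)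
  have h3 : 1 - (1 + v / σ ^ 2)⁻¹ = v / (σ ^ 2 + v) := by
    field_simp
    ring
  rw [h3] at h2
  calc v = (σ ^ 2 + v) * (v / (σ ^ 2 + v)) := by field_simp
    _ ≤ (σ ^ 2 + κ) * (v / (σ ^ 2 + v)) := by gcongr
    _ ≤ _ := by
      have : 0 ≤ σ ^ 2 + κ := by linarith
      gcongr

/-- Each variance is at most a constant times the information its point adds, and the increments
telescope (the elliptical potential argument). -/
theorem sum_gpVar_le (hk : ∀ z w, k z w = inner ℝ (φ z) (φ w)) (hσ : 0 < σ)
    (hκ : ∀ z, k z z ≤ κ) (q : ℕ → Z) (N : ℕ) :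
    ∑ n ∈ Finset.range N, gpVar k σ (fun i : Fin n => q i) (q n) ≤
      2 * (σ ^ 2 + κ) * maxInfoGain k σ N := by
  have hκ0 : 0 ≤ κ := le_trans (by rw [hk]; exact real_inner_self_nonneg) (hκ (q 0))
  calc ∑ n ∈ Finset.range N, gpVar k σ (fun i : Fin n => q i) (q n)
      ≤ ∑ n ∈ Finset.range N, 2 * (σ ^ 2 + κ) *
          ((1 / 2) * Real.log (1 + gpVar k σ (fun i : Fin n => q i) (q n) / σ ^ 2)) := by
        refine Finset.sum_le_sum fun n _ => ?_
        refine (gpVar_le_mul_log hk hσ hκ _ _).trans_eq ?_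
        ring
    _ = 2 * (σ ^ 2 + κ) * infoGain k σ (fun i : Fin N => q i) := by
        rw [infoGain_eq_sum hk hσ, Finset.mul_sum]
    _ ≤ _ := by
        have := infoGain_le_maxInfoGain hk hσ hκ (Fintype.card_fin N) (fun i : Fin N => q i)
        gcongr

/-- Measuring the same point N times is one of the designs in the supremum. This lower bound lets
constants be absorbed into γ_N. -/
theorem half_log_le_maxInfoGain (hk : ∀ z w, k z w = inner ℝ (φ z) (φ w)) (hσ : 0 < σ)
    (hκ : ∀ z, k z z ≤ κ) (z : Z) {N : ℕ} (hN : 1 ≤ N) :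
    (1 / 2) * Real.log (1 + k z z / σ ^ 2) ≤ maxInfoGain k σ N := by
  refine le_trans ?_ (infoGain_le_maxInfoGain hk hσ hκ (Fintype.card_fin N) fun _ => z)
  rw [infoGain_eq_sum hk hσ (fun _ => z)]
  -- The prior variance is the posterior variance given no data, so the bound is the first summand
  -- of the chain rule.
  have h0 : k z z = gpVar k σ (fun _ : Fin 0 => z) z := by simp [gpVar_eq]
  rw [h0]
  refine Finset.single_le_sum (f := fun n : ℕ => (1 / 2) *
    Real.log (1 + gpVar k σ (fun _ : Fin n => z) z / σ ^ 2)) (fun n _ => ?_)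
    (Finset.mem_range.2 hN)
  have := gpVar_nonneg hk hσ (fun _ : Fin n => z) z
  have : 0 ≤ Real.log (1 + gpVar k σ (fun _ : Fin n => z) z / σ ^ 2) :=
    Real.log_nonneg (by have : 0 ≤ gpVar k σ (fun _ : Fin n => z) z / σ ^ 2 := by positivity
                        linarith)
  positivity

/-- The error of the posterior mean, in terms of the self-normalized noise. -/
theorem abs_gpMean_sub_le (hk : ∀ z w, k z w = inner ℝ (φ z) (φ w)) (hσ : 0 < σ) (p : ι → Z)
    (h : H) (ε : ι → ℝ) (z : Z) :
    |gpMean k σ p (fun a => inner ℝ h (φ (p a)) + ε a) z - inner ℝ h (φ z)| ≤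
      (‖h‖ + √((ε ⬝ᵥ ε) / σ ^ 2 - ε ⬝ᵥ regSolve k σ p ε)) * √(gpVar k σ p z) := by
  set w := regSolve k σ p fun a => k (p a) z with hw
  set α := regSolve k σ p ε with hα
  have hα' : regMatrix k σ p *ᵥ α = ε := regMatrix_mulVec_regSolve hk hσ p ε
  set u := ∑ a, α a • φ (p a) with hu
  set r := φ z - ∑ a, w a • φ (p a) with hr
  have hV : gpVar k σ p z = ‖r‖ ^ 2 + σ ^ 2 * (w ⬝ᵥ w) := gpVar_eq_norm hk hσ p z
  have hww : 0 ≤ w ⬝ᵥ w := Finset.sum_nonneg fun a _ => mul_self_nonneg (w a)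
  -- Noise is averaged with the optimal weights `w`; the bias sees only the residual `r` of
  -- approximating φ z.
  have hsplit : gpMean k σ p (fun a => inner ℝ h (φ (p a)) + ε a) z - inner ℝ h (φ z) =
      w ⬝ᵥ ε - inner ℝ h r := by
    rw [gpMean_eq, dotProduct_regSolve_comm hk hσ, ← hw, hr, inner_sub_right, inner_sum]
    simp only [dotProduct, mul_add, Finset.sum_add_distrib, inner_smul_right]
    ring
  -- Since (K + σ²I)α = ε, this vector is Kα; it is the coordinate form of the feature vector `u`.
  set β : ι → ℝ := ε - σ ^ 2 • α with hβ
  have hKα : ∀ x : ι → ℝ, inner ℝ (∑ a, x a • φ (p a)) u = x ⬝ᵥ β := by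
    intro x
    have := dotProduct_regMatrix_mulVec (σ := σ) hk p x α
    rw [hα'] at this
    rw [hβ, dotProduct_sub, dotProduct_smul, this, smul_eq_mul]
    ring
  have hwε : w ⬝ᵥ ε = inner ℝ r u + w ⬝ᵥ β := by
    rw [hr, inner_sub_left, hKα, sub_add_cancel, hu, inner_sum_smul_eq_dotProduct hk,
      dotProduct_regSolve_comm hk hσ]
  have hQ : (ε ⬝ᵥ ε) / σ ^ 2 - ε ⬝ᵥ α = ‖u‖ ^ 2 + (β ⬝ᵥ β) / σ ^ 2 := by
    have h1 : ‖u‖ ^ 2 = α ⬝ᵥ β := by rw [← real_inner_self_eq_norm_sq, ← hKα α]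
    rw [h1]
    have h2 : ε = β + σ ^ 2 • α := by rw [hβ]; simp
    rw [h2]
    simp only [add_dotProduct, dotProduct_add, smul_dotProduct, dotProduct_smul, smul_eq_mul,
      dotProduct_comm α β]
    field_simp
    ring
  have hββ : 0 ≤ β ⬝ᵥ β := Finset.sum_nonneg fun a _ => mul_self_nonneg (β a)
  have hCS : (w ⬝ᵥ β) ^ 2 ≤ (w ⬝ᵥ w) * (β ⬝ᵥ β) := by
    simpa [dotProduct, sq] using Finset.sum_mul_sq_le_sq_mul_sq Finset.univ w β
  -- Cauchy–Schwarz in H × ℝ^ι for the pairs (r, σw) and (u, β/σ): their squared norms are the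
  -- posterior variance and the self-normalized noise.
  have hbound : |w ⬝ᵥ ε| ≤ √(‖u‖ ^ 2 + (β ⬝ᵥ β) / σ ^ 2) * √(gpVar k σ p z) := by
    rw [← Real.sqrt_mul (by positivity), hV, hwε]
    apply Real.abs_le_sqrt
    have h1 : |inner ℝ r u| ≤ ‖r‖ * ‖u‖ := abs_real_inner_le_norm r u
    have h2 : |w ⬝ᵥ β| ≤ √(w ⬝ᵥ w) * √(β ⬝ᵥ β) := by
      rw [← Real.sqrt_mul hww]
      exact Real.abs_le_sqrt hCS
    have h3 : |inner ℝ r u + w ⬝ᵥ β| ≤ ‖r‖ * ‖u‖ + √(w ⬝ᵥ w) * √(β ⬝ᵥ β) :=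
      (abs_add_le _ _).trans (add_le_add h1 h2)
    rw [← sq_abs]
    refine (pow_le_pow_left₀ (abs_nonneg _) h3 2).trans ?_
    have h4 : (√(w ⬝ᵥ w)) ^ 2 = w ⬝ᵥ w := Real.sq_sqrt hww
    have h5 : (√(β ⬝ᵥ β)) ^ 2 = β ⬝ᵥ β := Real.sq_sqrt hββ
    set x := √(w ⬝ᵥ w)
    set y := √(β ⬝ᵥ β)
    rw [← h4, ← h5]
    have : (‖u‖ ^ 2 + y ^ 2 / σ ^ 2) * (‖r‖ ^ 2 + σ ^ 2 * x ^ 2) -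
        (‖r‖ * ‖u‖ + x * y) ^ 2 = (σ * x * ‖u‖ - ‖r‖ * y / σ) ^ 2 := by
      field_simp
      ring
    nlinarith [sq_nonneg (σ * x * ‖u‖ - ‖r‖ * y / σ)]
  have hr' : |inner ℝ h r| ≤ ‖h‖ * √(gpVar k σ p z) := by
    refine (abs_real_inner_le_norm h r).trans ?_
    gcongr
    apply Real.le_sqrt_of_sq_le
    rw [hV]
    have : 0 ≤ σ ^ 2 * (w ⬝ᵥ w) := by positivity
    linarith
  rw [hsplit, hQ, add_mul]
  calc |w ⬝ᵥ ε - inner ℝ h r| ≤ |w ⬝ᵥ ε| + |inner ℝ h r| := abs_sub _ _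
    _ ≤ _ := by linarith

end InfoGain

/-! ### The Gaussian likelihood ratio and its one-step mean -/

section Likelihood

variable {Z ι κ : Type*} [Fintype ι] [DecidableEq ι] [Fintype κ] [DecidableEq κ]
  {H : Type*} [NormedAddCommGroup H] [InnerProductSpace ℝ H]
  {k : Z → Z → ℝ} {φ : Z → H} {σ : ℝ}

/-- The likelihood ratio of the laws `N(0, K + σ² I)` and `N(0, σ² I)` at the point `y`. -/
def likelihoodRatio {Z ι : Type*} [Fintype ι] [DecidableEq ι] (k : Z → Z → ℝ) (σ : ℝ)
    (p : ι → Z) (y : ι → ℝ) : ℝ :=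
  Real.exp ((1 / 2) * ((y ⬝ᵥ y) / σ ^ 2 - y ⬝ᵥ regSolve k σ p y) - infoGain k σ p)

theorem likelihoodRatio_pos (p : ι → Z) (y : ι → ℝ) : 0 < likelihoodRatio k σ p y :=
  Real.exp_pos _

theorem likelihoodRatio_comp (p : κ → Z) (y : κ → ℝ) (e : ι ≃ κ) :
    likelihoodRatio k σ (p ∘ e) (y ∘ e) = likelihoodRatio k σ p y := by
  simp only [likelihoodRatio, infoGain_comp, regSolve_comp, comp_equiv_dotProduct_comp_equiv]

theorem likelihoodRatio_of_isEmpty [IsEmpty ι] (p : ι → Z) (y : ι → ℝ) :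
    likelihoodRatio k σ p y = 1 := by
  simp [likelihoodRatio, infoGain]

/-- Under N(0, K + σ²I) the new observation, given the old ones, has the predictive law with mean
`gpMean` and variance `gpVar + σ ^ 2`; under N(0, σ²I) it is plain noise. The exponents match by the
Schur recursion and the normalizations by the chain rule for the information gain. -/
theorem likelihoodRatio_sumElim (hk : ∀ z w, k z w = inner ℝ (φ z) (φ w)) {σ : ℝ≥0}
    (hσ : 0 < σ) (p : ι → Z) (z : Z) (y : ι → ℝ) (t : ℝ) :
    gaussianPDFReal 0 (σ ^ 2) t * likelihoodRatio k σ (Sum.elim p fun _ : Fin 1 => z)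
        (Sum.elim y fun _ => t) =
      likelihoodRatio k σ p y *
        gaussianPDFReal (gpMean k σ p y z) ((gpVar k σ p z).toNNReal + σ ^ 2) t := by
  have hσ' : (0 : ℝ) < σ := hσ
  have hv := gpVar_nonneg hk hσ' p z
  rw [likelihoodRatio, likelihoodRatio, infoGain_sumElim hk hσ', dotProduct_regSolve_sumElim hk hσ',
    gaussianPDFReal, gaussianPDFReal]
  push_cast
  rw [Real.coe_toNNReal _ hv]
  set v := gpVar k σ p z
  set m := gpMean k σ p y z
  have hyt : Sum.elim y (fun _ : Fin 1 => t) ⬝ᵥ Sum.elim y (fun _ => t) = y ⬝ᵥ y + t ^ 2 := by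
    simp [dotProduct, sq]
  have hlog : Real.exp (-((1 / 2) * Real.log (1 + v / (σ : ℝ) ^ 2))) =
      (√(1 + v / (σ : ℝ) ^ 2))⁻¹ := by
    have h1 : 0 < 1 + v / (σ : ℝ) ^ 2 := by positivity
    rw [Real.exp_neg, Real.sqrt_eq_rpow, Real.rpow_def_of_pos h1, mul_comm]
  have hsq : √(2 * Real.pi * (v + (σ : ℝ) ^ 2)) =
      √(2 * Real.pi * (σ : ℝ) ^ 2) * √(1 + v / (σ : ℝ) ^ 2) := by
    rw [← Real.sqrt_mul (by positivity)]
    congr 1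
    field_simp
    ring
  rw [hyt, hsq, mul_inv, ← hlog]
  have hpos : v + (σ : ℝ) ^ 2 ≠ 0 := by positivity
  calc _ = (√(2 * Real.pi * (σ : ℝ) ^ 2))⁻¹ * (Real.exp (-(t - 0) ^ 2 / (2 * (σ : ℝ) ^ 2)) *
        Real.exp (1 / 2 * ((y ⬝ᵥ y + t ^ 2) / (σ : ℝ) ^ 2 - (y ⬝ᵥ regSolve k σ p y +
          (t - m) ^ 2 / (v + (σ : ℝ) ^ 2))) -
          (infoGain k σ p + 1 / 2 * Real.log (1 + v / (σ : ℝ) ^ 2)))) := by ring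
    _ = (√(2 * Real.pi * (σ : ℝ) ^ 2))⁻¹ * (Real.exp (1 / 2 * ((y ⬝ᵥ y) / (σ : ℝ) ^ 2 -
          y ⬝ᵥ regSolve k σ p y) - infoGain k σ p) *
          (Real.exp (-(1 / 2 * Real.log (1 + v / (σ : ℝ) ^ 2))) *
            Real.exp (-(t - m) ^ 2 / (2 * (v + (σ : ℝ) ^ 2))))) := by
        rw [← Real.exp_add, ← Real.exp_add, ← Real.exp_add]
        congr 2
        field_simp
        ring
    _ = _ := by ring

/-- The martingale step for frozen past: the predictive density integrates to one. -/
theorem lintegral_likelihoodRatio_sumElim (hk : ∀ z w, k z w = inner ℝ (φ z) (φ w)) {σ : ℝ≥0}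
    (hσ : 0 < σ) (p : ι → Z) (z : Z) (y : ι → ℝ)
    (hmeas : Measurable fun t => likelihoodRatio k σ (Sum.elim p fun _ : Fin 1 => z)
        (Sum.elim y fun _ => t)) :
    ∫⁻ t, ENNReal.ofReal (likelihoodRatio k σ (Sum.elim p fun _ : Fin 1 => z)
        (Sum.elim y fun _ => t)) ∂gaussianReal 0 (σ ^ 2) =
      ENNReal.ofReal (likelihoodRatio k σ p y) := by
  have h0 : σ ^ 2 ≠ 0 := by positivity
  have h1 : (gpVar k σ p z).toNNReal + σ ^ 2 ≠ 0 := by positivity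
  rw [gaussianReal_of_var_ne_zero _ h0,
    lintegral_withDensity_eq_lintegral_mul _ (measurable_gaussianPDF _ _) hmeas.ennreal_ofReal]
  have h2 : ∀ t, (gaussianPDF 0 (σ ^ 2) * fun t => ENNReal.ofReal (likelihoodRatio k σ
      (Sum.elim p fun _ : Fin 1 => z) (Sum.elim y fun _ => t))) t =
      ENNReal.ofReal (likelihoodRatio k σ p y) * ENNReal.ofReal
        (gaussianPDFReal (gpMean k σ p y z) ((gpVar k σ p z).toNNReal + σ ^ 2) t) := fun t => by
    rw [Pi.mul_apply, gaussianPDF, ← ENNReal.ofReal_mul (gaussianPDFReal_nonneg _ _ _),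
      likelihoodRatio_sumElim hk hσ, ENNReal.ofReal_mul (likelihoodRatio_pos p y).le]
  rw [lintegral_congr h2, lintegral_const_mul _ (measurable_gaussianPDFReal _ _).ennreal_ofReal,
    lintegral_gaussianPDFReal_eq_one _ h1, mul_one]

theorem measurable_det {Ω : Type*} [MeasurableSpace Ω] {M : Ω → Matrix ι ι ℝ}
    (hM : ∀ a b, Measurable fun ω => M ω a b) : Measurable fun ω => (M ω).det := by
  simp only [Matrix.det_apply]
  fun_prop

theorem measurable_regSolve {Ω : Type*} [MeasurableSpace Ω] [MeasurableSpace Z]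
    (hk : Measurable (Function.uncurry k)) {p : ι → Ω → Z} (hp : ∀ a, Measurable (p a))
    {y : ι → Ω → ℝ} (hy : ∀ a, Measurable (y a)) (a : ι) :
    Measurable fun ω => regSolve k σ (fun a => p a ω) (fun a => y a ω) a := by
  have hK : ∀ a b, Measurable fun ω => regMatrix k σ (fun a => p a ω) a b := fun a b =>
    (hk.comp ((hp a).prodMk (hp b))).add_const _
  -- Cramer's rule reduces measurability of the inverse to that of determinants.
  simp only [regSolve, Matrix.inv_def, Matrix.smul_apply, smul_eq_mul, Ring.inverse_eq_inv',
    Matrix.mulVec, dotProduct]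
  refine Finset.measurable_fun_sum _ fun b _ =>
    Measurable.mul (Measurable.mul (measurable_det hK).inv ?_) (hy b)
  simp only [Matrix.adjugate_apply]
  refine measurable_det fun i j => ?_
  simp only [Matrix.updateRow_apply]
  split_ifs
  · exact measurable_const
  · exact hK i j

theorem measurable_likelihoodRatio {Ω : Type*} [MeasurableSpace Ω] [MeasurableSpace Z]
    (hk : Measurable (Function.uncurry k)) {p : ι → Ω → Z} (hp : ∀ a, Measurable (p a))
    {y : ι → Ω → ℝ} (hy : ∀ a, Measurable (y a)) :
    Measurable fun ω => likelihoodRatio k σ (fun a => p a ω) (fun a => y a ω) := by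
  have hkk : ∀ a b, Measurable fun ω => k (p a ω) (p b ω) := fun a b =>
    hk.comp ((hp a).prodMk (hp b))
  have hK : ∀ a b, Measurable fun ω =>
      (1 + (σ ^ 2)⁻¹ • kernelMatrix k (fun a => p a ω)) a b := fun a b =>
    ((hkk a b).const_mul (σ ^ 2)⁻¹).const_add ((1 : Matrix ι ι ℝ) a b)
  have hgain : Measurable fun ω => infoGain k σ (fun a => p a ω) :=
    ((measurable_det hK).log).const_mul _
  have hs := measurable_regSolve (σ := σ) hk hp hy
  simp only [likelihoodRatio, dotProduct]
  fun_prop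

end Likelihood

/-! ### Ville's inequality -/

section Ville

/-- Ville's maximal inequality. -/
theorem measure_exists_le_of_martingale {Ω : Type*} {mΩ : MeasurableSpace Ω} {P : Measure Ω}
    [IsProbabilityMeasure P] (ℱ : Filtration ℕ mΩ) {f : ℕ → Ω → ℝ} (hf0 : ∀ n ω, 0 ≤ f n ω)
    (hmeas : ∀ n, Measurable[ℱ n] (f n)) (hone : ∀ ω, f 0 ω = 1)
    (hstep : ∀ n A, MeasurableSet[ℱ n] A →
      ∫⁻ ω in A, ENNReal.ofReal (f (n + 1) ω) ∂P = ∫⁻ ω in A, ENNReal.ofReal (f n ω) ∂P)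
    {c : ℝ} (hc : 0 < c) : P {ω | ∃ n, c ≤ f n ω} ≤ ENNReal.ofReal (1 / c) := by
  have hmeas' : ∀ n, Measurable (f n) := fun n => (hmeas n).mono (ℱ.le n) le_rfl
  have hlint : ∀ n, ∫⁻ ω, ENNReal.ofReal (f n ω) ∂P = 1 := by
    intro n
    induction n with
    | zero => simp [hone]
    | succ n ih =>
      have := hstep n univ MeasurableSet.univ
      rwa [setLIntegral_univ, setLIntegral_univ, ih] at this
  have hint : ∀ n, Integrable (f n) P := fun n =>
    (lintegral_ofReal_ne_top_iff_integrable (hmeas' n).aestronglyMeasurable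
      (ae_of_all _ (hf0 n))).1 (by rw [hlint]; simp)
  have hsub : Submartingale f ℱ P := by
    refine submartingale_of_setIntegral_le_succ (fun n => (hmeas n).stronglyMeasurable) hint ?_
    intro n A hA
    rw [integral_eq_lintegral_of_nonneg_ae (ae_of_all _ (hf0 _))
      (hmeas' _).aestronglyMeasurable, integral_eq_lintegral_of_nonneg_ae (ae_of_all _ (hf0 _))
      (hmeas' _).aestronglyMeasurable, hstep n A hA]
  have hfin : ∀ N : ℕ, P {ω | ∃ n ≤ N, c ≤ f n ω} ≤ ENNReal.ofReal (1 / c) := by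
    intro N
    have h1 := maximal_ineq hsub (fun n ω => hf0 n ω) (ε := c.toNNReal) N
    rw [Real.coe_toNNReal c hc.le] at h1
    have h2 : {ω | c ≤ (Finset.range (N + 1)).sup' Finset.nonempty_range_add_one fun k => f k ω} =
        {ω | ∃ n ≤ N, c ≤ f n ω} := by
      ext ω
      simp [Finset.le_sup'_iff]
    rw [h2] at h1
    have h3 : ∫ ω in {ω | ∃ n ≤ N, c ≤ f n ω}, f N ω ∂P ≤ 1 := by
      refine (setIntegral_le_integral (hint N) (ae_of_all _ (hf0 N))).trans ?_
      rw [integral_eq_lintegral_of_nonneg_ae (ae_of_all _ (hf0 _))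
        (hmeas' _).aestronglyMeasurable, hlint]
      simp
    have h4 := h1.trans (ENNReal.ofReal_le_ofReal h3)
    rw [one_div, ENNReal.ofReal_inv_of_pos hc, ← one_div,
      ENNReal.le_div_iff_mul_le (Or.inl (by simpa using hc)) (Or.inl (by simp)), mul_comm]
    simpa [ENNReal.ofReal] using h4
  have hU : {ω | ∃ n, c ≤ f n ω} = ⋃ N : ℕ, {ω | ∃ n ≤ N, c ≤ f n ω} := by
    ext ω
    simp only [mem_ofPred_eq, mem_iUnion]
    exact ⟨fun ⟨n, h⟩ => ⟨n, n, le_rfl, h⟩, fun ⟨_, n, _, h⟩ => ⟨n, h⟩⟩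
  have hmono : Monotone fun N : ℕ => {ω | ∃ n ≤ N, c ≤ f n ω} :=
    fun N M hNM ω ⟨n, hn, h⟩ => ⟨n, hn.trans hNM, h⟩
  rw [hU, hmono.measure_iUnion]
  exact iSup_le hfin

end Ville

/-! ### The martingale step for a random past -/

section Step

variable {Z ι : Type*} [Fintype ι] [DecidableEq ι] [MeasurableSpace Z]
  {H : Type*} [NormedAddCommGroup H] [InnerProductSpace ℝ H]
  {k : Z → Z → ℝ} {φ : Z → H} {σ : ℝ≥0}

/-- `X` carries all that is known before the measurement. By independence its joint law with the new
noise is a product, so Fubini integrates the noise first, with past data and new point fixed. -/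
theorem setLIntegral_likelihoodRatio_sumElim {Ω S : Type*} [MeasurableSpace Ω] [MeasurableSpace S]
    {P : Measure Ω} [IsProbabilityMeasure P]
    (hk : ∀ z w, k z w = inner ℝ (φ z) (φ w)) (hkm : Measurable (Function.uncurry k)) (hσ : 0 < σ)
    {X : Ω → S} (hX : Measurable X) {e : Ω → ℝ} (he : Measurable e)
    (hlaw : P.map e = gaussianReal 0 (σ ^ 2)) (hind : IndepFun X e P)
    {p : ι → S → Z} (hp : ∀ a, Measurable (p a)) {y : ι → S → ℝ} (hy : ∀ a, Measurable (y a))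
    {z : S → Z} (hz : Measurable z) {A : Set S} (hA : MeasurableSet A) :
    ∫⁻ ω in X ⁻¹' A, ENNReal.ofReal (likelihoodRatio k σ
        (Sum.elim (fun a => p a (X ω)) fun _ : Fin 1 => z (X ω))
        (Sum.elim (fun a => y a (X ω)) fun _ => e ω)) ∂P =
      ∫⁻ ω in X ⁻¹' A, ENNReal.ofReal (likelihoodRatio k σ
        (fun a => p a (X ω)) (fun a => y a (X ω))) ∂P := by
  have hL : Measurable fun st : S × ℝ => likelihoodRatio k σ
      (Sum.elim (fun a => p a st.1) fun _ : Fin 1 => z st.1)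
      (Sum.elim (fun a => y a st.1) fun _ => st.2) := by
    have h := measurable_likelihoodRatio (σ := σ) hkm (ι := ι ⊕ Fin 1) (Ω := S × ℝ)
      (p := Sum.elim (fun a st => p a st.1) fun _ st => z st.1)
      (y := Sum.elim (fun a st => y a st.1) fun _ st => st.2)
      (by rintro (a | a)
          · exact (hp a).comp measurable_fst
          · exact hz.comp measurable_fst)
      (by rintro (a | a)
          · exact (hy a).comp measurable_fst
          · exact measurable_snd)
    convert h using 3 with st
    · ext (a | a) <;> rfl
    · ext (a | a) <;> rfl
  have hF : Measurable fun st : S × ℝ => A.indicator (fun _ => (1 : ℝ≥0∞)) st.1 *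
      ENNReal.ofReal (likelihoodRatio k σ
        (Sum.elim (fun a => p a st.1) fun _ : Fin 1 => z st.1)
        (Sum.elim (fun a => y a st.1) fun _ => st.2)) :=
    ((measurable_const.indicator hA).comp measurable_fst).mul hL.ennreal_ofReal
  have hprod : P.map (fun ω => (X ω, e ω)) = (P.map X).prod (P.map e) :=
    (indepFun_iff_map_prod_eq_prod_map_map hX.aemeasurable he.aemeasurable).1 hind
  have hset : ∀ g : Ω → ℝ≥0∞, ∫⁻ ω in X ⁻¹' A, g ω ∂P =
      ∫⁻ ω, A.indicator (fun _ => (1 : ℝ≥0∞)) (X ω) * g ω ∂P := by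
    intro g
    rw [← lintegral_indicator (hX hA)]
    refine lintegral_congr fun ω => ?_
    by_cases h : X ω ∈ A <;> simp [h]
  rw [hset, hset]
  calc _ = ∫⁻ st, A.indicator (fun _ => (1 : ℝ≥0∞)) st.1 * ENNReal.ofReal (likelihoodRatio k σ
        (Sum.elim (fun a => p a st.1) fun _ : Fin 1 => z st.1)
        (Sum.elim (fun a => y a st.1) fun _ => st.2)) ∂(P.map fun ω => (X ω, e ω)) :=
      (lintegral_map hF (hX.prodMk he)).symm
    _ = ∫⁻ s, A.indicator (fun _ => (1 : ℝ≥0∞)) s * ENNReal.ofReal (likelihoodRatio k σ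
        (fun a => p a s) (fun a => y a s)) ∂(P.map X) := by
      have := Measure.isProbabilityMeasure_map hX.aemeasurable (μ := P)
      have := Measure.isProbabilityMeasure_map he.aemeasurable (μ := P)
      rw [hprod, lintegral_prod _ hF.aemeasurable]
      refine lintegral_congr fun s => ?_
      have hs : Measurable fun t => likelihoodRatio k σ
          (Sum.elim (fun a => p a s) fun _ : Fin 1 => z s)
          (Sum.elim (fun a => y a s) fun _ => t) := by
        have h := hL.comp (measurable_prodMk_left (x := s))
        simpa only [Function.comp_def] using h
      have hone := lintegral_likelihoodRatio_sumElim hk hσ (fun a => p a s) (z s)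
        (fun a => y a s) hs
      dsimp only
      rw [hlaw]
      refine (lintegral_const_mul _ hs.ennreal_ofReal).trans ?_
      rw [hone]
    _ = _ := by
      refine lintegral_map ((measurable_const.indicator hA).mul
        (Measurable.ennreal_ofReal ?_)) hX
      exact measurable_likelihoodRatio (σ := σ) hkm hp hy

end Step

/-! ### σ-algebras generated by the noise -/

section Noise

variable {Ω : Type*} {mΩ : MeasurableSpace Ω} {P : Measure Ω} {d : ℕ} {σ : ℝ≥0}
  {noise : ℕ → ℕ → Fin d → Ω → ℝ}

/-- The information generated by the noise variables with indices in `S`. -/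
@[reducible] def noiseInfo {Ω : Type*} {d : ℕ} (noise : ℕ → ℕ → Fin d → Ω → ℝ)
    (S : Set (ℕ × ℕ × Fin d)) : MeasurableSpace Ω :=
  ⨆ q ∈ S, MeasurableSpace.comap (noise q.1 q.2.1 q.2.2) inferInstance

omit mΩ in
theorem noiseInfo_mono {S S' : Set (ℕ × ℕ × Fin d)} (h : S ⊆ S') :
    noiseInfo noise S ≤ noiseInfo noise S' :=
  biSup_mono fun _ hq => h hq

omit mΩ in
theorem measurable_noise {S : Set (ℕ × ℕ × Fin d)} {n i : ℕ} {j : Fin d} (h : (n, i, j) ∈ S) :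
    Measurable[noiseInfo noise S] (noise n i j) := by
  have : MeasurableSpace.comap (noise n i j) inferInstance ≤ noiseInfo noise S :=
    le_biSup (fun q : ℕ × ℕ × Fin d =>
      MeasurableSpace.comap (noise q.1 q.2.1 q.2.2) inferInstance) h
  exact (comap_measurable _).mono this le_rfl

omit mΩ in
theorem history_eq_noiseInfo (n : ℕ) :
    history noise n = noiseInfo noise {q | q.1 ∈ Finset.Icc 1 n} := by
  apply le_antisymm
  · refine iSup₂_le fun p hp => iSup_le fun i => iSup_le fun j => ?_
    exact le_biSup (fun q : ℕ × ℕ × Fin d =>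
      MeasurableSpace.comap (noise q.1 q.2.1 q.2.2) inferInstance)
      (show (p, i, j) ∈ {q : ℕ × ℕ × Fin d | q.1 ∈ Finset.Icc 1 n} from hp)
  · refine iSup₂_le fun q hq => ?_
    refine le_trans ?_ (le_biSup (fun p => ⨆ i : ℕ, ⨆ j : Fin d,
      MeasurableSpace.comap (noise p i j) inferInstance) hq)
    exact le_iSup_of_le q.2.1 (le_iSup_of_le q.2.2 le_rfl)

theorem noiseInfo_le (h : ∀ n i j, Measurable (noise n i j)) (S : Set (ℕ × ℕ × Fin d)) :
    noiseInfo noise S ≤ mΩ :=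
  iSup₂_le fun q _ => (h q.1 q.2.1 q.2.2).comap_le

theorem IsGaussianNoise.indep (h : IsGaussianNoise P σ noise) {S : Set (ℕ × ℕ × Fin d)}
    {n i : ℕ} {j : Fin d} (hS : (n, i, j) ∉ S) :
    Indep (noiseInfo noise S) (MeasurableSpace.comap (noise n i j) inferInstance) P := by
  have h1 := indep_iSup_of_disjoint
    (m := fun q : ℕ × ℕ × Fin d => MeasurableSpace.comap (noise q.1 q.2.1 q.2.2) inferInstance)
    (fun q => (h.1 q.1 q.2.1 q.2.2).comap_le) h.2.2
    (S := S) (T := {(n, i, j)}) (by simpa using hS)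
  simpa using h1

/-- The filtration generated by the noise. -/
def noiseFiltration (h : ∀ n i j, Measurable (noise n i j)) : Filtration ℕ mΩ where
  seq n := history noise n
  mono' n m hnm := by
    simp only [history_eq_noiseInfo]
    refine noiseInfo_mono fun q hq => ?_
    simp only [mem_ofPred_eq, Finset.mem_Icc] at hq ⊢
    omega
  le' n := by
    simp only [history_eq_noiseInfo]
    exact noiseInfo_le h _

end Noise

/-! ### The feature map of the reproducing kernel Hilbert space -/

section Reproducing

variable {Z : Type*} {H : Type*} [NormedAddCommGroup H] [InnerProductSpace ℝ H] [CompleteSpace H]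
  [RKHS ℝ H Z ℝ]

theorem scalarKernel_eq_inner (z w : Z) :
    scalarKernel H z w = inner ℝ (RKHS.kerFun H z (1 : ℝ)) (RKHS.kerFun H w (1 : ℝ)) := by
  have h := RKHS.kernel_inner H z w (1 : ℝ) (1 : ℝ)
  rw [real_inner_comm, ← h]
  simp [scalarKernel]

theorem apply_eq_inner_kerFun (h : H) (z : Z) : h z = inner ℝ h (RKHS.kerFun H z (1 : ℝ)) := by
  rw [RKHS.inner_kerFun]
  simp

end Reproducing

theorem sum_Icc_one_eq_sum_range {M : Type*} [AddCommMonoid M] (g : ℕ → M) (n : ℕ) :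
    ∑ p ∈ Finset.Icc 1 n, g p = ∑ i ∈ Finset.range n, g (i + 1) := by
  induction n with
  | zero => simp
  | succ n ih => rw [Finset.sum_Icc_succ_top (by omega), Finset.sum_range_succ, ih]

/-! ### Calibration of the confidence sets -/

namespace Episodes

variable {dx du : ℕ} {X : Set (Vec dx)} {U : Set (Vec du)} {Ω : Type*} {mΩ : MeasurableSpace Ω}
  {P : Measure Ω} [IsProbabilityMeasure P] {R : Episodes X U Ω}
  {k : StateAction X U → StateAction X U → ℝ} {σ : ℝ≥0} {H : Type*} [NormedAddCommGroup H]
  [InnerProductSpace ℝ H] {φ : StateAction X U → H} {noise : ℕ → ℕ → Fin dx → Ω → ℝ}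

/-- The data indices of the episodes `1, …, n + 1` are those of the episodes `1, …, n` together
with those of episode `n + 1`. -/
def dataIndexSuccEquiv (R : Episodes X U Ω) (n : ℕ) :
    R.DataIndex n ⊕ Fin (R.count (n + 1)) ≃ R.DataIndex (n + 1) :=
  Equiv.ofBijective
    (Sum.elim (fun a => ⟨a.1.castSucc, a.2⟩) fun i => ⟨Fin.last n, i⟩) <| by
    constructor
    · rintro (⟨a, i⟩ | i) (⟨b, l⟩ | l) h
      · simp only [Sum.elim_inl, Sigma.mk.injEq, Fin.castSucc_inj] at h
        obtain ⟨rfl, h⟩ := h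
        simpa using h
      · simp only [Sum.elim_inl, Sum.elim_inr, Sigma.mk.injEq] at h
        exact absurd h.1 (Fin.castSucc_lt_last a).ne
      · simp only [Sum.elim_inl, Sum.elim_inr, Sigma.mk.injEq] at h
        exact absurd h.1 (Fin.castSucc_lt_last b).ne'
      · simpa using h
    · rintro ⟨a, i⟩
      induction a using Fin.lastCases with
      | last => exact ⟨Sum.inr i, rfl⟩
      | cast a => exact ⟨Sum.inl ⟨a, i⟩, rfl⟩

theorem card_dataIndex (R : Episodes X U Ω) (n : ℕ) :
    Fintype.card (R.DataIndex n) = R.totalCount n := by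
  simp only [Fintype.card_sigma, Fintype.card_fin, totalCount, sum_Icc_one_eq_sum_range]
  exact Fin.sum_univ_eq_sum_range (fun p => R.count (p + 1)) n

/-- The likelihood ratio for the noise of the episodes `1, …, n` and of the first `r` measurements
of episode `n + 1`. -/
def partialRatio (R : Episodes X U Ω) (k : StateAction X U → StateAction X U → ℝ) (σ : ℝ)
    (noise : ℕ → ℕ → Fin dx → Ω → ℝ) (j : Fin dx) (n r : ℕ) (ω : Ω) : ℝ :=
  likelihoodRatio k σ
    (Sum.elim (R.dataPoint n ω) fun i : Fin r => R.point (n + 1) i ω)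
    (Sum.elim (fun a : R.DataIndex n => noise (a.1 + 1) a.2 j ω)
      fun i : Fin r => noise (n + 1) i j ω)

/-- The likelihood ratio for the noise of the episodes `1, …, n`. -/
def dataRatio (R : Episodes X U Ω) (k : StateAction X U → StateAction X U → ℝ) (σ : ℝ)
    (noise : ℕ → ℕ → Fin dx → Ω → ℝ) (j : Fin dx) (n : ℕ) (ω : Ω) : ℝ :=
  likelihoodRatio k σ (R.dataPoint n ω) fun a : R.DataIndex n => noise (a.1 + 1) a.2 j ω

omit mΩ in
theorem partialRatio_zero (j : Fin dx) (n : ℕ) (ω : Ω) :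
    R.partialRatio k σ noise j n 0 ω = R.dataRatio k σ noise j n ω := by
  rw [partialRatio, dataRatio, ← likelihoodRatio_comp _ _ (Equiv.sumEmpty _ (Fin 0)).symm]
  rfl

omit mΩ in
theorem partialRatio_count (j : Fin dx) (n : ℕ) (ω : Ω) :
    R.partialRatio k σ noise j n (R.count (n + 1)) ω = R.dataRatio k σ noise j (n + 1) ω := by
  rw [partialRatio, dataRatio, ← likelihoodRatio_comp _ _ (R.dataIndexSuccEquiv n)]
  congr 1
  · ext1 (a | a) <;> rfl
  · ext1 (a | a) <;> rfl

/-- An episode brings several measurements, but its points are all fixed by the earlier episodes.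
The measurements can therefore be added singly, each with noise independent of everything already in
the ratio. -/
theorem setLIntegral_partialRatio_succ
    (hk : ∀ z w, k z w = inner ℝ (φ z) (φ w)) (hkm : Measurable (Function.uncurry k)) (hσ : 0 < σ)
    (hnoise : IsGaussianNoise P σ noise)
    (hpoint : ∀ n, ∀ i < R.count (n + 1), Measurable[history noise n] (R.point (n + 1) i))
    (j : Fin dx) {n r : ℕ} (hr : r < R.count (n + 1)) {A : Set Ω}
    (hA : MeasurableSet[history noise n] A) :
    ∫⁻ ω in A, ENNReal.ofReal (R.partialRatio k σ noise j n (r + 1) ω) ∂P =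
      ∫⁻ ω in A, ENNReal.ofReal (R.partialRatio k σ noise j n r ω) ∂P := by
  -- All coordinates are included: the points may depend on every coordinate of the past noise.
  set S : Set (ℕ × ℕ × Fin dx) := {q | q.1 ∈ Finset.Icc 1 n ∨ (q.1 = n + 1 ∧ q.2.1 < r)} with hS
  have hle : ∀ {m : ℕ}, m ≤ n → history noise m ≤ noiseInfo noise S := by
    intro m hm
    rw [history_eq_noiseInfo]
    refine noiseInfo_mono fun q hq => Or.inl ?_
    simp only [mem_ofPred_eq, Finset.mem_Icc] at hq ⊢
    omega
  have hSle : noiseInfo noise S ≤ mΩ := noiseInfo_le hnoise.1 S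
  have hnot : (n + 1, r, j) ∉ S := by
    simp [hS]
  have hind' : @IndepFun Ω Ω ℝ mΩ (noiseInfo noise S) _ id (noise (n + 1) r j) P := by
    refine (@IndepFun_iff_Indep Ω Ω ℝ mΩ (noiseInfo noise S) _ id (noise (n + 1) r j) P).2 ?_
    rw [MeasurableSpace.comap_id]
    exact hnoise.indep hnot
  -- The past is represented by the identity map into Ω equipped with the smaller σ-algebra
  -- `noiseInfo noise S`.
  have key := @setLIntegral_likelihoodRatio_sumElim (StateAction X U) (R.DataIndex n ⊕ Fin r) _ _ _
    H _ _ k φ σ Ω Ω mΩ (noiseInfo noise S) P _ hk hkm hσ id (measurable_id'' hSle)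
    (noise (n + 1) r j) (hnoise.1 _ _ _) (hnoise.2.1 _ _ _)
    hind'
    (Sum.elim (fun a ω => R.dataPoint n ω a) fun i : Fin r => R.point (n + 1) i)
    (by
      rintro (a | i)
      · exact (hpoint a.1 a.2 a.2.2).mono (hle a.1.2.le) le_rfl
      · exact (hpoint n i (i.2.trans hr)).mono (hle le_rfl) le_rfl)
    (Sum.elim (fun a ω => noise (a.1 + 1) a.2 j ω) fun i : Fin r => noise (n + 1) i j)
    (by
      rintro (a | i)
      · refine measurable_noise (Or.inl ?_)
        have := a.1.2
        simp only [Finset.mem_Icc]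
        omega
      · exact measurable_noise (Or.inr ⟨rfl, i.2⟩))
    (R.point (n + 1) r) ((hpoint n r hr).mono (hle le_rfl) le_rfl) A (hle le_rfl A hA)
  refine Eq.trans ?_ (key.trans ?_)
  · refine lintegral_congr fun ω => ?_
    congr 1
    rw [partialRatio, ← likelihoodRatio_comp _ _ ((Equiv.sumAssoc (R.DataIndex n) (Fin r)
      (Fin 1)).trans (Equiv.sumCongr (Equiv.refl _) (finSumFinEquiv : Fin r ⊕ Fin 1 ≃ _)))]
    congr 1
    · ext1 ((a | a) | a)
      · rfl
      · rfl
      · obtain rfl := Subsingleton.elim a 0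
        rfl
    · ext1 ((a | a) | a)
      · rfl
      · rfl
      · obtain rfl := Subsingleton.elim a 0
        rfl
  · refine lintegral_congr fun ω => ?_
    congr 1
    rw [partialRatio]
    congr 1
    · ext1 (a | a) <;> rfl
    · ext1 (a | a) <;> rfl

theorem setLIntegral_dataRatio_succ
    (hk : ∀ z w, k z w = inner ℝ (φ z) (φ w)) (hkm : Measurable (Function.uncurry k)) (hσ : 0 < σ)
    (hnoise : IsGaussianNoise P σ noise)
    (hpoint : ∀ n, ∀ i < R.count (n + 1), Measurable[history noise n] (R.point (n + 1) i))
    (j : Fin dx) (n : ℕ) {A : Set Ω} (hA : MeasurableSet[history noise n] A) :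
    ∫⁻ ω in A, ENNReal.ofReal (R.dataRatio k σ noise j (n + 1) ω) ∂P =
      ∫⁻ ω in A, ENNReal.ofReal (R.dataRatio k σ noise j n ω) ∂P := by
  have h : ∀ r ≤ R.count (n + 1), ∫⁻ ω in A, ENNReal.ofReal (R.partialRatio k σ noise j n r ω) ∂P =
      ∫⁻ ω in A, ENNReal.ofReal (R.dataRatio k σ noise j n ω) ∂P := by
    intro r hr
    induction r with
    | zero => simp only [partialRatio_zero]
    | succ r ih =>
      rw [setLIntegral_partialRatio_succ hk hkm hσ hnoise hpoint j hr hA, ih (Nat.le_of_succ_le hr)]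
  simpa only [partialRatio_count] using h _ le_rfl

/-- The noise is never unlikely, in the self-normalized sense. -/
theorem measure_exists_le_dataRatio
    (hk : ∀ z w, k z w = inner ℝ (φ z) (φ w)) (hkm : Measurable (Function.uncurry k)) (hσ : 0 < σ)
    (hnoise : IsGaussianNoise P σ noise)
    (hpoint : ∀ n, ∀ i < R.count (n + 1), Measurable[history noise n] (R.point (n + 1) i))
    (j : Fin dx) {c : ℝ} (hc : 0 < c) :
    P {ω | ∃ n, c ≤ R.dataRatio k σ noise j n ω} ≤ ENNReal.ofReal (1 / c) := by
  have : IsEmpty (R.DataIndex 0) := ⟨fun a => a.1.elim0⟩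
  refine measure_exists_le_of_martingale (noiseFiltration hnoise.1)
    (f := R.dataRatio k σ noise j) (fun n ω => (likelihoodRatio_pos _ _).le) (fun n => ?_)
    (fun ω => likelihoodRatio_of_isEmpty _ _)
    (fun n A hA => setLIntegral_dataRatio_succ hk hkm hσ hnoise hpoint j n hA) hc
  refine @measurable_likelihoodRatio _ (R.DataIndex n) _ _ _ _ Ω (history noise n) _ hkm
    (fun a ω => R.dataPoint n ω a) (fun a => ?_) (fun a ω => noise (a.1 + 1) a.2 j ω) (fun a => ?_)
  · exact (hpoint a.1 a.2 a.2.2).mono ((noiseFiltration hnoise.1).mono a.1.2.le) le_rfl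
  · rw [history_eq_noiseInfo]
    refine measurable_noise ?_
    have := a.1.2
    simp only [mem_ofPred_eq, Finset.mem_Icc]
    omega

/-- A violated confidence bound in coordinate j forces the likelihood ratio of that coordinate up to
dx/δ. Ville's inequality gives each coordinate the failure probability δ/dx, and these add up to δ.
-/
theorem wellCalibrated [CompleteSpace H] [RKHS ℝ H (StateAction X U) ℝ]
    (hk : k = scalarKernel H) (hkm : Measurable (Function.uncurry k)) {κ : ℝ}
    (hκ : ∀ z, k z z ≤ κ) (hσ : 0 < σ) {B : ℝ} {f : StateAction X U → Vec dx}
    (hf : InRKHSBall H B f) {δ : ℝ} (hδ : 0 < δ)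
    (hnoise : IsGaussianNoise P σ noise)
    (hpoint : ∀ n, ∀ i < R.count (n + 1), Measurable[history noise n] (R.point (n + 1) i))
    {β : ℕ → ℝ} (hβ : ∀ n,
      B + √(2 * (maxInfoGain k σ (R.totalCount n) + Real.log (dx / δ))) ≤ β n) :
    R.WellCalibrated P k σ f noise β δ := by
  have hk' : ∀ z w, k z w =
      inner ℝ (RKHS.kerFun H z (1 : ℝ)) (RKHS.kerFun H w (1 : ℝ)) := fun z w => by
    rw [hk, scalarKernel_eq_inner]
  have hσ' : (0 : ℝ) < σ := hσ
  -- For dx = 0 the level dx/δ is not positive and Ville's inequality does not apply, but there is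
  -- nothing to violate.
  rcases Nat.eq_zero_or_pos dx with rfl | hdx
  · have : {ω | ¬ ∀ n, f ∈ R.confidenceSet k σ f noise β n ω} = ∅ := by
      ext ω
      simp [confidenceSet]
    rw [WellCalibrated, this]
    simp
  have hdx' : (0 : ℝ) < dx := by exact_mod_cast hdx
  have hsub : {ω | ¬ ∀ n, f ∈ R.confidenceSet k σ f noise β n ω} ⊆
      ⋃ j : Fin dx, {ω | ∃ n, dx / δ ≤ R.dataRatio k σ noise j n ω} := by
    intro ω hω
    simp only [mem_ofPred_eq, not_forall] at hω
    obtain ⟨n, hn⟩ := hω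
    by_contra hcon
    simp only [mem_iUnion, mem_ofPred_eq, not_exists, not_le] at hcon
    refine hn fun z j => ?_
    obtain ⟨h, hB, hh⟩ := hf j
    have hlt := hcon j n
    set ε : R.DataIndex n → ℝ := fun a => noise (a.1 + 1) a.2 j ω with hε
    have hmean := abs_gpMean_sub_le hk' hσ' (R.dataPoint n ω) h ε z
    have hobs : R.dataObs f noise n ω j =
        fun a => inner ℝ h (RKHS.kerFun H (R.dataPoint n ω a) (1 : ℝ)) + ε a := by
      funext a
      rw [dataObs, hh, apply_eq_inner_kerFun]
    rw [← hobs, ← apply_eq_inner_kerFun, ← hh] at hmean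
    refine hmean.trans ?_
    refine mul_le_mul_of_nonneg_right (le_trans ?_ (hβ n)) (Real.sqrt_nonneg _)
    refine add_le_add hB (Real.sqrt_le_sqrt ?_)
    -- The logarithm of the ratio is Q/2 minus the information gain, so Q < 2(gain + log(dx/δ)).
    rw [dataRatio, likelihoodRatio, ← Real.lt_log_iff_exp_lt (by positivity)] at hlt
    have hgain := infoGain_le_maxInfoGain hk' hσ' hκ (card_dataIndex R n) (R.dataPoint n ω)
    linarith
  refine (measure_mono hsub).trans ((measure_iUnion_le _).trans ?_)
  rw [tsum_fintype]
  refine (Finset.sum_le_sum fun j _ =>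
    measure_exists_le_dataRatio hk' hkm hσ hnoise hpoint j (c := dx / δ) (by positivity)).trans ?_
  rw [Finset.sum_const, Finset.card_univ, Fintype.card_fin, nsmul_eq_mul,
    ← ENNReal.ofReal_natCast, ← ENNReal.ofReal_mul (by positivity)]
  apply ENNReal.ofReal_le_ofReal
  field_simp
  exact le_rfl

end Episodes

/-! ### Grönwall estimates for trajectories and costs -/

section Gronwall

theorem gronwallBound_zero_eq_mul (L ε t : ℝ) :
    gronwallBound 0 L ε t = ε * gronwallBound 0 L 1 t := by
  unfold gronwallBound
  split_ifs <;> ring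

theorem gronwallBound_zero_nonneg {L t : ℝ} (hL : 0 ≤ L) (ht : 0 ≤ t) :
    0 ≤ gronwallBound 0 L 1 t := by
  simpa [gronwallBound_x0] using gronwallBound_mono le_rfl zero_le_one hL ht

theorem gronwallBound_zero_le_mul_exp {L : ℝ} (hL : 0 ≤ L) (t : ℝ) :
    gronwallBound 0 L 1 t ≤ t * Real.exp (L * t) := by
  unfold gronwallBound
  split_ifs with h
  · simp [h]
  · have hL' : 0 < L := lt_of_le_of_ne hL (Ne.symm h)
    have h1 := Real.add_one_le_exp (-(L * t))
    have h2 : Real.exp (-(L * t)) * Real.exp (L * t) = 1 := by rw [← Real.exp_add]; simp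
    have h3 : Real.exp (L * t) - 1 ≤ L * t * Real.exp (L * t) := by
      nlinarith [Real.exp_pos (L * t)]
    calc 0 * Real.exp (L * t) + 1 / L * (Real.exp (L * t) - 1)
        ≤ 0 * Real.exp (L * t) + 1 / L * (L * t * Real.exp (L * t)) := by gcongr
      _ = t * Real.exp (L * t) := by field_simp; ring

/-- Replaces the factor t of `gronwallBound_zero_le_mul_exp` by 1/L. The discretization error of the
equidistant rule already carries a factor T, and this form keeps the total at T². -/
theorem gronwallBound_zero_le_exp_div {L t : ℝ} (hL : 0 < L) :
    gronwallBound 0 L 1 t ≤ Real.exp (L * t) / L := by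
  rw [gronwallBound, if_neg hL.ne']
  calc 0 * Real.exp (L * t) + 1 / L * (Real.exp (L * t) - 1)
      = Real.exp (L * t) / L - 1 / L := by ring
    _ ≤ _ := by
      have : 0 < 1 / L := by positivity
      linarith

end Gronwall

section Trajectory

variable {dx du : ℕ} {X : Set (Vec dx)} {U : Set (Vec du)} {π : X → U} {Lπ Lf Lc : ℝ≥0}
  {f g : StateAction X U → Vec dx} {x₀ : X} {T : ℝ} {x y : ℝ → X}

theorem dist_withAction_le (hπ : LipschitzWith Lπ π) (x y : X) :
    dist (withAction π x) (withAction π y) ≤ (1 + Lπ) * ‖(x : Vec dx) - y‖ := by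
  have h1 : dist (withAction π x) (withAction π y) =
      √(‖(x : Vec dx) - y‖ ^ 2 + ‖(π x : Vec du) - π y‖ ^ 2) := by
    rw [Subtype.dist_eq, dist_eq_norm, WithLp.prod_norm_eq_of_L2]
    rfl
  have h2 : ‖(π x : Vec du) - π y‖ ≤ Lπ * ‖(x : Vec dx) - y‖ := by
    have := hπ.dist_le_mul x y
    rwa [Subtype.dist_eq, Subtype.dist_eq, dist_eq_norm, dist_eq_norm] at this
  rw [h1]
  apply Real.sqrt_le_iff.2 ⟨by positivity, ?_⟩
  have h3 := pow_le_pow_left₀ (norm_nonneg _) h2 2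
  have h4 : 0 ≤ (Lπ : ℝ) * ‖(x : Vec dx) - y‖ ^ 2 := by positivity
  nlinarith

theorem lipschitzWith_withAction (hπ : LipschitzWith Lπ π) :
    LipschitzWith (1 + Lπ) (withAction π) := by
  refine LipschitzWith.of_dist_le_mul fun x y => ?_
  rw [Subtype.dist_eq x y, dist_eq_norm]
  exact_mod_cast dist_withAction_le hπ x y

theorem IsTrajectory.continuousOn (h : IsTrajectory f π x₀ T x) :
    ContinuousOn (fun s => (x s : Vec dx)) (Icc 0 T) :=
  fun t ht => (h.2 t ht).continuousWithinAt

theorem IsTrajectory.continuousOn' (h : IsTrajectory f π x₀ T x) : ContinuousOn x (Icc 0 T) :=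
  Topology.IsInducing.subtypeVal.continuousOn_iff.2 h.continuousOn

/-- Grönwall's inequality for two trajectories under the same policy, where the mismatch of the
dynamics is controlled along the first of them. -/
theorem IsTrajectory.norm_sub_le (hx : IsTrajectory f π x₀ T x) (hy : IsTrajectory g π x₀ T y)
    (hπ : LipschitzWith Lπ π) (hg : LipschitzWith Lf g) {E : ℝ}
    (hE : ∀ t ∈ Icc 0 T, ‖f (withAction π (x t)) - g (withAction π (x t))‖ ≤ E) {t : ℝ}
    (ht : t ∈ Icc 0 T) :
    ‖(x t : Vec dx) - y t‖ ≤ E * gronwallBound 0 (Lf * (1 + Lπ)) 1 t := by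
  have key := norm_le_gronwallBound_of_norm_deriv_right_le (a := 0) (b := T) (δ := 0)
    (f := fun s => (x s : Vec dx) - y s) (K := Lf * (1 + Lπ)) (ε := E)
    (f' := fun s => f (withAction π (x s)) - g (withAction π (y s)))
    (hx.continuousOn.sub hy.continuousOn)
    (fun s hs => ((hx.2 s (Ico_subset_Icc_self hs)).sub
      (hy.2 s (Ico_subset_Icc_self hs))).mono_of_mem_nhdsWithin (Icc_mem_nhdsGE_of_mem hs))
    (by simp [hx.1, hy.1])
    (fun s hs => by
      have h1 := hE s (Ico_subset_Icc_self hs)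
      have h2 : ‖g (withAction π (x s)) - g (withAction π (y s))‖ ≤
          Lf * ((1 + Lπ) * ‖(x s : Vec dx) - y s‖) := by
        rw [← dist_eq_norm]
        refine (hg.dist_le_mul _ _).trans ?_
        gcongr
        exact dist_withAction_le hπ _ _
      -- Inserting g at the first trajectory requires the mismatch only along `x` and Lipschitz
      -- continuity only of `g`. The regret bound takes the true trajectory for `x`, the adaptive
      -- rule the simulated one.
      have h3 := norm_sub_le_norm_sub_add_norm_sub (f (withAction π (x s)))
        (g (withAction π (x s))) (g (withAction π (y s)))
      linarith)
    t ht
  rwa [sub_zero, gronwallBound_zero_eq_mul] at key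

theorem IsTrajectory.norm_sub_le_mul (hx : IsTrajectory f π x₀ T x) {F : ℝ}
    (hF : ∀ z, ‖f z‖ ≤ F) {s t : ℝ} (hs : s ∈ Icc 0 T) (ht : t ∈ Icc 0 T) :
    ‖(x t : Vec dx) - x s‖ ≤ F * |t - s| :=
  (convex_Icc 0 T).norm_image_sub_le_of_norm_hasDerivWithin_le (fun r hr => hx.2 r hr)
    (fun _ _ => hF _) hs ht

theorem IsTrajectory.shift (hx : IsTrajectory f π x₀ T x) {a τ : ℝ} (ha : 0 ≤ a)
    (hτ : a + τ ≤ T) : IsTrajectory f π (x a) τ fun t => x (a + t) := by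
  refine ⟨by simp, fun t ht => ?_⟩
  have h1 : HasDerivWithinAt (fun s => a + s) 1 (Icc 0 τ) t :=
    ((hasDerivAt_id t).const_add a).hasDerivWithinAt
  have h2 := (hx.2 (a + t) ⟨by linarith [ht.1], by linarith [ht.2]⟩).scomp t h1
    (fun s hs => ⟨by linarith [hs.1], by linarith [hs.2]⟩)
  simpa [Function.comp_def] using h2

theorem runCost_sub_le {c : StateAction X U → ℝ} (hc : LipschitzWith Lc c)
    (hT : 0 ≤ T) (hx : IsTrajectory f π x₀ T x) (hy : IsTrajectory g π x₀ T y)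
    (hπ : LipschitzWith Lπ π) (hg : LipschitzWith Lf g) {E : ℝ} (hE0 : 0 ≤ E)
    (hE : ∀ t ∈ Icc 0 T, ‖f (withAction π (x t)) - g (withAction π (x t))‖ ≤ E) :
    runCost c T π x - runCost c T π y ≤
      Lc * ((1 + Lπ) * (E * gronwallBound 0 (Lf * (1 + Lπ)) 1 T)) * T := by
  have hcont : ∀ {h : StateAction X U → Vec dx} {w : ℝ → X}, IsTrajectory h π x₀ T w →
      IntervalIntegrable (fun t => c (withAction π (w t))) volume 0 T := fun hw =>
    ContinuousOn.intervalIntegrable (by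
      rw [uIcc_of_le hT]
      exact (hc.continuous.comp (lipschitzWith_withAction hπ).continuous).comp_continuousOn
        hw.continuousOn')
  rw [runCost, runCost, ← intervalIntegral.integral_sub (hcont hx) (hcont hy)]
  refine (le_abs_self _).trans ?_
  have h := intervalIntegral.norm_integral_le_of_norm_le_const (a := 0) (b := T)
    (f := fun t => c (withAction π (x t)) - c (withAction π (y t)))
    (C := Lc * ((1 + Lπ) * (E * gronwallBound 0 (Lf * (1 + Lπ)) 1 T))) (fun t ht => by
      rw [uIoc_of_le hT] at ht
      have ht' := Ioc_subset_Icc_self ht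
      rw [← dist_eq_norm]
      refine (hc.dist_le_mul _ _).trans ?_
      have h1 := dist_withAction_le hπ (x t) (y t)
      have h2 := hx.norm_sub_le hy hπ hg hE ht'
      have h3 : gronwallBound 0 (Lf * (1 + Lπ)) 1 t ≤ gronwallBound 0 (Lf * (1 + Lπ)) 1 T :=
        gronwallBound_mono le_rfl zero_le_one (by positivity) ht.2
      refine mul_le_mul_of_nonneg_left (h1.trans ?_) (by positivity)
      refine mul_le_mul_of_nonneg_left (h2.trans ?_) (by positivity)
      gcongr)
  rwa [sub_zero, abs_of_nonneg hT, Real.norm_eq_abs] at h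

end Trajectory

/-! ### From optimism to regret -/

namespace Episodes

variable {dx du : ℕ} {X : Set (Vec dx)} {U : Set (Vec du)} {Ω : Type*}
  {R : Episodes X U Ω} {k : StateAction X U → StateAction X U → ℝ} {σ κ : ℝ} {H : Type*}
  [NormedAddCommGroup H] [InnerProductSpace ℝ H] {φ : StateAction X U → H}
  {noise : ℕ → ℕ → Fin dx → Ω → ℝ} {f : StateAction X U → Vec dx} {β : ℕ → ℝ}
  {c : StateAction X U → ℝ} {T : ℝ} {x₀ : X} {Pol : Set (X → U)}
  {Dyn : Set (StateAction X U → Vec dx)} {πstar : X → U} {xstar : ℝ → X} {Lc Lπ Lf Lσ : ℝ≥0}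
  {n : ℕ} {ω : Ω}

/-- Both maps lie within βσ of the posterior mean in each coordinate; hence the 2. -/
theorem norm_sub_le_of_mem_confidenceSet (hβ : 0 ≤ β n)
    {g₁ g₂ : StateAction X U → Vec dx}
    (hf : g₁ ∈ R.confidenceSet k σ f noise β n ω)
    (hg : g₂ ∈ R.confidenceSet k σ f noise β n ω)
    (z : StateAction X U) : ‖g₁ z - g₂ z‖ ≤ 2 * β n * ‖R.std k σ n ω z‖ := by
  have h : ∀ j, |g₁ z j - g₂ z j| ≤ |((2 * β n) • R.std k σ n ω z) j| := by
    intro j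
    have h1 := hf z j
    have h2 := hg z j
    rw [abs_le] at h1 h2
    refine le_trans ?_ (le_abs_self _)
    rw [PiLp.smul_apply, smul_eq_mul, abs_le]
    constructor <;> linarith
  have h2 : ‖(2 * β n) • R.std k σ n ω z‖ = 2 * β n * ‖R.std k σ n ω z‖ := by
    rw [norm_smul, Real.norm_of_nonneg (by positivity)]
  rw [← h2, EuclideanSpace.norm_eq, EuclideanSpace.norm_eq]
  refine Real.sqrt_le_sqrt (Finset.sum_le_sum fun j _ => ?_)
  exact pow_le_pow_left₀ (norm_nonneg _) (h j) 2

theorem norm_std_sq (hk : ∀ z w, k z w = inner ℝ (φ z) (φ w)) (hσ : 0 < σ)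
    (z : StateAction X U) :
    ‖R.std k σ n ω z‖ ^ 2 = dx * gpVar k σ (R.dataPoint n ω) z := by
  rw [EuclideanSpace.norm_sq_eq]
  simp [std, Real.sq_sqrt (gpVar_nonneg hk hσ _ _)]

/-- One measurement per episode is retained. Forgetting the others can only enlarge the variances,
and what remains is a sequence of N points; this is why γ_N appears instead of γ at the total number
of measurements. -/
theorem sum_norm_std_le (hk : ∀ z w, k z w = inner ℝ (φ z) (φ w)) (hσ : 0 < σ)
    (hκ : ∀ z, k z z ≤ κ) {i : ℕ → ℕ} (hi : ∀ n, i n < R.count (n + 1)) (N : ℕ) :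
    ∑ n ∈ Finset.range N, ‖R.std k σ n ω (R.point (n + 1) (i n) ω)‖ ≤
      √(2 * dx * (σ ^ 2 + κ)) * √(N * maxInfoGain k σ N) := by
  have hvar : ∀ n, gpVar k σ (R.dataPoint n ω) (R.point (n + 1) (i n) ω) ≤
      gpVar k σ (fun a : Fin n => R.point (a + 1) (i a) ω) (R.point (n + 1) (i n) ω) := by
    intro n
    refine gpVar_le_gpVar_comp hk hσ (R.dataPoint n ω)
      (e := fun a : Fin n => (⟨a, ⟨i a, hi a⟩⟩ : R.DataIndex n)) ?_ _
    intro a b hab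
    exact congrArg Sigma.fst hab
  have hsum : ∑ n ∈ Finset.range N, ‖R.std k σ n ω (R.point (n + 1) (i n) ω)‖ ^ 2 ≤
      dx * (2 * (σ ^ 2 + κ) * maxInfoGain k σ N) := by
    simp only [norm_std_sq hk hσ]
    rw [← Finset.mul_sum]
    refine mul_le_mul_of_nonneg_left ?_ (by positivity)
    exact (Finset.sum_le_sum fun n _ => hvar n).trans
      (sum_gpVar_le hk hσ hκ (fun n => R.point (n + 1) (i n) ω) N)
  have hκ0 : 0 ≤ κ := le_trans (by rw [hk]; exact real_inner_self_nonneg)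
    (hκ (R.point 0 0 ω))
  rw [← Real.sqrt_mul (by positivity)]
  apply Real.le_sqrt_of_sq_le
  have hCS := sq_sum_le_card_mul_sum_sq (s := Finset.range N)
    (f := fun n => ‖R.std k σ n ω (R.point (n + 1) (i n) ω)‖)
  rw [Finset.card_range] at hCS
  refine hCS.trans ((mul_le_mul_of_nonneg_left hsum (by positivity)).trans_eq ?_)
  ring

/-- Optimism: once `f` is plausible, the optimal policy paired with `f` is itself a candidate, so
the planning problem is solvable and its value is at most the optimal cost. -/
theorem IsOCoRL.plausible (hR : R.IsOCoRL k σ f noise β c T x₀ Pol Dyn)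
    (hopt : IsOptimalPolicy c T x₀ f Pol πstar xstar) (hfD : f ∈ Dyn)
    (hf : f ∈ R.confidenceSet k σ f noise β n ω) :
    R.Plausible k σ f noise β T x₀ Pol Dyn n ω
        (R.policy (n + 1) ω) (R.model (n + 1) ω) (R.planned (n + 1) ω) ∧
      runCost c T (R.policy (n + 1) ω) (R.planned (n + 1) ω) ≤ runCost c T πstar xstar := by
  have hp : R.Plausible k σ f noise β T x₀ Pol Dyn n ω πstar f xstar :=
    ⟨hopt.1, ⟨hf, hfD⟩, hopt.2.1⟩
  obtain ⟨h1, h2⟩ := hR.optimistic n ω ⟨_, _, _, hp⟩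
  exact ⟨h1, h2 _ _ _ hp⟩

/-- The regret bound for any measurement selection that measures, in every episode, a point where
the uncertainty controls the mismatch of the dynamics along the true trajectory. -/
theorem IsOCoRL.regret_le (hk : ∀ z w, k z w = inner ℝ (φ z) (φ w)) (hσ : 0 < σ)
    (hκ : ∀ z, k z z ≤ κ) (hT : 0 < T) (hc : LipschitzWith Lc c)
    (hPol : ∀ π ∈ Pol, LipschitzWith Lπ π) (hDyn : ∀ g ∈ Dyn, LipschitzWith Lf g)
    (hfD : f ∈ Dyn) (hopt : IsOptimalPolicy c T x₀ f Pol πstar xstar) (hβm : Monotone β)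
    (hβ0 : ∀ n, 0 ≤ β n) (hR : R.IsOCoRL k σ f noise β c T x₀ Pol Dyn)
    (hω : ∀ n, f ∈ R.confidenceSet k σ f noise β n ω) {a : ℝ} (ha : 0 ≤ a) {e : ℕ → ℝ}
    (he : ∀ n, 0 ≤ e n)
    (hsel : ∀ n, ∃ i < R.count (n + 1), ∀ t ∈ Icc 0 T,
      ‖f (R.stateAction (n + 1) ω t) - R.model (n + 1) ω (R.stateAction (n + 1) ω t)‖ ≤
        2 * β n * (a * ‖R.std k σ n ω (R.point (n + 1) i ω)‖ + e n)) (N : ℕ) :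
    R.regret c T πstar xstar N ω ≤
      2 * Lc * (1 + Lπ) * β N * T * gronwallBound 0 (Lf * (1 + Lπ)) 1 T *
        (a * (√(2 * dx * (σ ^ 2 + κ)) * √(N * maxInfoGain k σ N)) +
          ∑ n ∈ Finset.range N, e n) := by
  choose i hi hbound using hsel
  have hG : 0 ≤ gronwallBound 0 (Lf * (1 + Lπ)) 1 T :=
    gronwallBound_zero_nonneg (by positivity) hT.le
  set G := gronwallBound 0 (Lf * (1 + Lπ)) 1 T
  have hstep : ∀ n < N, runCost c T (R.policy (n + 1) ω) (R.traj (n + 1) ω) -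
      runCost c T πstar xstar ≤ 2 * Lc * (1 + Lπ) * β N * T * G *
        (a * ‖R.std k σ n ω (R.point (n + 1) (i n) ω)‖ + e n) := by
    intro n hn
    obtain ⟨⟨hpol, ⟨hconf, hmod⟩, htraj⟩, hle⟩ := hR.plausible hopt hfD (hω n)
    have h0 : 0 ≤ a * ‖R.std k σ n ω (R.point (n + 1) (i n) ω)‖ + e n :=
      add_nonneg (by positivity) (he n)
    have h1 := runCost_sub_le hc hT.le (hR.isTrajectory n ω) htraj (hPol _ hpol) (hDyn _ hmod)
      (mul_nonneg (mul_nonneg zero_le_two (hβ0 n)) h0) (hbound n)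
    have h2 : β n ≤ β N := hβm hn.le
    -- The optimal cost is replaced by the planned cost, leaving two dynamics under the same policy.
    calc _ ≤ _ := sub_le_sub_left hle _
      _ ≤ _ := h1
      _ = 2 * Lc * (1 + Lπ) * β n * T * G *
        (a * ‖R.std k σ n ω (R.point (n + 1) (i n) ω)‖ + e n) := by ring
      _ ≤ _ := by gcongr
  rw [regret, sum_Icc_one_eq_sum_range fun n =>
    runCost c T (R.policy n ω) (R.traj n ω) - runCost c T πstar xstar]
  refine (Finset.sum_le_sum fun n hn => hstep n (Finset.mem_range.1 hn)).trans ?_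
  rw [← Finset.mul_sum, Finset.sum_add_distrib, ← Finset.mul_sum]
  have hs := sum_norm_std_le (ω := ω) hk hσ hκ hi N
  have := hβ0 N
  gcongr

theorem norm_std_le_add {Lσ : ℝ≥0} (hstd : LipschitzWith Lσ (R.std k σ n ω)) {π : X → U}
    (hπ : LipschitzWith Lπ π) (x y : X) :
    ‖R.std k σ n ω (withAction π x)‖ ≤ ‖R.std k σ n ω (withAction π y)‖ +
      Lσ * (1 + Lπ) * ‖(x : Vec dx) - y‖ := by
  have h1 := hstd.dist_le_mul (withAction π x) (withAction π y)
  have h2 := dist_withAction_le hπ x y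
  have h3 : (Lσ : ℝ) * dist (withAction π x) (withAction π y) ≤
      Lσ * (1 + Lπ) * ‖(x : Vec dx) - y‖ := by
    rw [mul_assoc]
    gcongr
  have h4 := norm_le_norm_add_norm_sub' (R.std k σ n ω (withAction π x))
    (R.std k σ n ω (withAction π y))
  rw [dist_eq_norm] at h1
  linarith

end Episodes

/-! ### The three measurement rules and the number of measurements -/

namespace Episodes

section Selection

variable {dx du : ℕ} {X : Set (Vec dx)} {U : Set (Vec du)} {Ω : Type*}
  {R : Episodes X U Ω} {k : StateAction X U → StateAction X U → ℝ} {σ κ : ℝ} {H : Type*}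
  [NormedAddCommGroup H] [InnerProductSpace ℝ H] {φ : StateAction X U → H}
  {noise : ℕ → ℕ → Fin dx → Ω → ℝ} {f : StateAction X U → Vec dx} {β : ℕ → ℝ}
  {c : StateAction X U → ℝ} {T : ℝ} {x₀ : X} {Pol : Set (X → U)}
  {Dyn : Set (StateAction X U → Vec dx)} {πstar : X → U} {xstar : ℝ → X} {Lc Lπ Lf Lσ : ℝ≥0}
  {n : ℕ} {ω : Ω}

/-- In the adaptive strategy, the uncertainty on each interval of the true trajectory is controlled
by the uncertainty at the measurement in that interval. -/
theorem IsOCoRL.norm_std_le_of_adaptive (hT : 0 < T)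
    (hPol : ∀ π ∈ Pol, LipschitzWith Lπ π) (hDyn : ∀ g ∈ Dyn, LipschitzWith Lf g)
    (hfD : f ∈ Dyn) (hopt : IsOptimalPolicy c T x₀ f Pol πstar xstar) (hβm : Monotone β)
    (hβ0 : ∀ n, 0 ≤ β n) (hR : R.IsOCoRL k σ f noise β c T x₀ Pol Dyn)
    (hω : f ∈ R.confidenceSet k σ f noise β n ω)
    (hstd : LipschitzWith Lσ (R.std k σ n ω))
    (had : R.IsAdaptive k σ f noise β T Dyn Lf Lπ Lσ) :
    ∃ i < R.count (n + 1), ∀ t ∈ Icc 0 T,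
      ‖R.std k σ n ω (R.stateAction (n + 1) ω t)‖ ≤
        3 * ‖R.std k σ n ω (R.point (n + 1) i ω)‖ := by
  obtain ⟨Δ, hΔ⟩ := had
  obtain ⟨hΔ0, hΔeq, hcount, hmeas⟩ := hΔ n
  obtain ⟨⟨hpol, ⟨hconf, hmod⟩, -⟩, -⟩ := hR.plausible hopt hfD hω
  have hmeas := hmeas ω ⟨hconf, hmod⟩
  have hπ := hPol _ hpol
  set D := Δ (n + 1)
  have hlocal : ∀ i < R.count (n + 1), ∀ t ∈ Icc (i * D) (i * D + min D (T - i * D)),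
      ‖R.std k σ n ω (R.stateAction (n + 1) ω t)‖ ≤
        3 * ‖R.std k σ n ω (R.point (n + 1) i ω)‖ := by
    intro i hi t ht
    obtain ⟨x, s, hx, hs, hmax, htime⟩ := hmeas i hi
    set τ := min D (T - i * D)
    have hτD : τ ≤ D := min_le_left _ _
    have hiD : (0 : ℝ) ≤ i * D := by positivity
    have hy := (hR.isTrajectory n ω).shift hiD (τ := τ)
      (by have : τ ≤ T - i * D := min_le_right _ _
          linarith)
    set M := ‖R.std k σ n ω (withAction (R.policy (n + 1) ω) (x s))‖ with hM
    have hM0 : 0 ≤ M := norm_nonneg _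
    have hle : ∀ r ∈ Icc 0 τ, ‖R.std k σ n ω (withAction (R.policy (n + 1) ω) (x r))‖ ≤ M :=
      fun r hr => hmax hr
    -- Over one interval the simulated and the true state stay so close that the uncertainty changes
    -- by at most Γ(D)·D·M = M/2; this is what Δ = 1/(2Γ(Δ)) is designed for.
    have hclose : ∀ r ∈ Icc 0 τ,
        Lσ * (1 + Lπ) * ‖(x r : Vec dx) - R.traj (n + 1) ω (i * D + r)‖ ≤ M / 2 := by
      intro r hr
      have hE : ∀ u ∈ Icc 0 τ, ‖R.model (n + 1) ω (withAction (R.policy (n + 1) ω) (x u)) -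
          f (withAction (R.policy (n + 1) ω) (x u))‖ ≤ 2 * β n * M := by
        intro u hu
        have hu1 := norm_sub_le_of_mem_confidenceSet (hβ0 n) hconf hω
          (withAction (R.policy (n + 1) ω) (x u))
        have hu2 := mul_le_mul_of_nonneg_left (hle u hu) (mul_nonneg zero_le_two (hβ0 n))
        exact hu1.trans hu2
      have h1 : ‖(x r : Vec dx) - R.traj (n + 1) ω (i * D + r)‖ ≤
          2 * β n * M * gronwallBound 0 (Lf * (1 + Lπ)) 1 r :=
        hx.norm_sub_le hy hπ (hDyn _ hfD) hE hr
      have h2 : gronwallBound 0 (Lf * (1 + Lπ)) 1 r ≤ D * Real.exp (Lf * (1 + Lπ) * D) := by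
        refine (gronwallBound_mono le_rfl zero_le_one (by positivity) (hr.2.trans hτD)).trans ?_
        exact gronwallBound_zero_le_mul_exp (by positivity) _
      have h3 : β n ≤ β (n + 1) := hβm n.le_succ
      have h4 := hβ0 n
      calc Lσ * (1 + Lπ) * ‖(x r : Vec dx) - R.traj (n + 1) ω (i * D + r)‖
          ≤ Lσ * (1 + Lπ) * (2 * β n * M * gronwallBound 0 (Lf * (1 + Lπ)) 1 r) := by gcongr
        _ ≤ Lσ * (1 + Lπ) *
            (2 * β (n + 1) * M * (D * Real.exp (Lf * (1 + Lπ) * D))) := by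
          have := hβ0 (n + 1)
          gcongr
          exact gronwallBound_zero_nonneg (by positivity) hr.1
        _ = M / 2 * (D * (2 * Gam Lf Lπ Lσ (β (n + 1)) D)) := by
          rw [Gam]
          ring
        _ = M / 2 := by rw [hΔeq, mul_one]
    have ht' : t - i * D ∈ Icc 0 τ := ⟨by linarith [ht.1], by linarith [ht.2]⟩
    have h1 := norm_std_le_add hstd hπ (R.traj (n + 1) ω (i * D + (t - i * D))) (x (t - i * D))
    rw [norm_sub_rev] at h1
    have h2 := hclose _ ht'
    have h3 := hle _ ht'
    have h4 := norm_std_le_add hstd hπ (x s) (R.traj (n + 1) ω (i * D + s))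
    have h5 := hclose _ hs
    have hpt : R.point (n + 1) i ω =
        withAction (R.policy (n + 1) ω) (R.traj (n + 1) ω (i * D + s)) := by
      rw [point, stateAction, htime]
    have hst : R.stateAction (n + 1) ω t =
        withAction (R.policy (n + 1) ω) (R.traj (n + 1) ω (i * D + (t - i * D))) := by
      rw [stateAction, add_sub_cancel]
    rw [hpt, hst]
    -- The true uncertainty at time t is at most M + M/2, and at the measured true point at least M
    -- − M/2: the ratio is 3.
    linarith
  have hpos : 0 < R.count (n + 1) := by
    rw [hcount]
    exact Nat.ceil_pos.2 (by positivity)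
  have : Nonempty (Fin (R.count (n + 1))) := ⟨⟨0, hpos⟩⟩
  -- One measurement must serve the whole horizon: the interval with the largest measured
  -- uncertainty is selected.
  obtain ⟨i, hi⟩ := Finite.exists_max fun i : Fin (R.count (n + 1)) =>
    ‖R.std k σ n ω (R.point (n + 1) i ω)‖
  refine ⟨i, i.2, fun t ht => ?_⟩
  have hcover : ∃ l < R.count (n + 1), t ∈ Icc (l * D) (l * D + min D (T - l * D)) := by
    rw [hcount]
    -- At t = T the floor can exceed the last index (when D divides T), so the endpoint is assigned
    -- to the last interval by hand.
    rcases lt_or_eq_of_le ht.2 with h | h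
    · refine ⟨⌊t / D⌋₊, ?_, ?_, ?_⟩
      · rw [Nat.lt_ceil]
        exact (Nat.floor_le (by have := ht.1; positivity)).trans_lt (by gcongr)
      · rw [← le_div_iff₀ hΔ0]
        exact Nat.floor_le (by have := ht.1; positivity)
      · rw [add_min]
        refine le_min ?_ (by linarith)
        have := (Nat.lt_floor_add_one (t / D)).le
        rw [div_le_iff₀ hΔ0] at this
        linarith
    · have hc : 0 < ⌈T / D⌉₊ := Nat.ceil_pos.2 (by positivity)
      have hlt : ((⌈T / D⌉₊ - 1 : ℕ) : ℝ) < T / D := by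
        rw [← Nat.lt_ceil]
        omega
      refine ⟨⌈T / D⌉₊ - 1, by omega, ?_, ?_⟩
      · rw [h]
        rw [lt_div_iff₀ hΔ0] at hlt
        exact hlt.le
      · rw [add_min]
        refine le_min ?_ (by linarith)
        have h1 := Nat.le_ceil (T / D)
        rw [div_le_iff₀ hΔ0] at h1
        have h2 : ((⌈T / D⌉₊ - 1 : ℕ) : ℝ) = ⌈T / D⌉₊ - 1 := by
          rw [Nat.cast_sub hc]
          simp
        rw [h, h2]
        linarith
  obtain ⟨l, hl, htl⟩ := hcover
  refine (hlocal l hl t htl).trans ?_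
  have := hi ⟨l, hl⟩
  linarith

/-- In the equidistant strategy, the uncertainty on the true trajectory is controlled by the largest
uncertainty at a measurement, up to a discretization error. -/
theorem IsOCoRL.norm_std_le_of_equidistant (hT : 0 < T)
    (hPol : ∀ π ∈ Pol, LipschitzWith Lπ π)
    (hR : R.IsOCoRL k σ f noise β c T x₀ Pol Dyn) {F : ℝ} (hF : ∀ z, ‖f z‖ ≤ F)
    (hstd : LipschitzWith Lσ (R.std k σ n ω)) (heq : R.IsEquidistant T) :
    ∃ i < R.count (n + 1), ∀ t ∈ Icc 0 T,
      ‖R.std k σ n ω (R.stateAction (n + 1) ω t)‖ ≤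
        ‖R.std k σ n ω (R.point (n + 1) i ω)‖ + Lσ * (1 + Lπ) * F * T * (1 / ((n : ℝ) + 1)) := by
  obtain ⟨τ, hτ⟩ := heq
  obtain ⟨hcount, hτn, htime⟩ := hτ n
  have hπ := hPol _ (hR.policy_mem n ω)
  have hn : (0 : ℝ) < (n : ℝ) + 1 := by positivity
  have : Nonempty (Fin (R.count (n + 1))) := ⟨⟨0, by omega⟩⟩
  obtain ⟨i, hi⟩ := Finite.exists_max fun i : Fin (R.count (n + 1)) =>
    ‖R.std k σ n ω (R.point (n + 1) i ω)‖
  refine ⟨i, i.2, fun t ht => ?_⟩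
  set D := T / ((n : ℝ) + 1) with hD
  have hD0 : 0 < D := by positivity
  have hDT : ((n : ℝ) + 1) * D = T := by rw [hD]; field_simp
  have hcover : ∃ l < n + 1, (l : ℝ) * D ≤ t ∧ t ≤ (l : ℝ) * D + D := by
    rcases lt_or_eq_of_le ht.2 with h | h
    · refine ⟨⌊t / D⌋₊, ?_, ?_, ?_⟩
      · rw [Nat.floor_lt (by have := ht.1; positivity), div_lt_iff₀ hD0]
        push_cast
        linarith
      · rw [← le_div_iff₀ hD0]
        exact Nat.floor_le (by have := ht.1; positivity)
      · have := (Nat.lt_floor_add_one (t / D)).le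
        rw [div_le_iff₀ hD0] at this
        linarith
    · exact ⟨n, by omega, by linarith, by linarith⟩
  obtain ⟨l, hl, hl1, hl2⟩ := hcover
  have hl' : l < R.count (n + 1) := by omega
  have h1 := norm_std_le_add hstd hπ (R.traj (n + 1) ω t)
    (R.traj (n + 1) ω (R.time (n + 1) l ω))
  have h2 := (hR.isTrajectory n ω).norm_sub_le_mul hF (hR.time_mem n ω l hl') ht
  -- Both times lie in the cell [lD, lD + D], because the offset τ lies in [0, D].
  have h3 : |t - R.time (n + 1) l ω| ≤ D := by
    rw [htime l hl ω, abs_le]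
    have := hτn.1
    have := hτn.2
    constructor <;> linarith
  have hF0 : 0 ≤ F := (norm_nonneg _).trans (hF (R.stateAction (n + 1) ω t))
  have h4 : Lσ * (1 + Lπ) * ‖(R.traj (n + 1) ω t : Vec dx) -
      R.traj (n + 1) ω (R.time (n + 1) l ω)‖ ≤ Lσ * (1 + Lπ) * (F * D) := by
    gcongr
    exact h2.trans (by gcongr)
  have h5 : Lσ * (1 + Lπ) * (F * D) = Lσ * (1 + Lπ) * F * T * (1 / ((n : ℝ) + 1)) := by
    rw [hD]
    ring
  have h6 := hi ⟨l, hl'⟩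
  rw [← h5]
  exact h1.trans (add_le_add h6 h4)

/-- Covers the oracle (a = 1) and the adaptive rule (a = 3) with one constant, whose 6 is 2 · 3. -/
theorem IsOCoRL.regret_le_of_norm_std_le (hk : ∀ z w, k z w = inner ℝ (φ z) (φ w)) (hσ : 0 < σ)
    (hκ : ∀ z, k z z ≤ κ) (hT : 0 < T) (hc : LipschitzWith Lc c)
    (hPol : ∀ π ∈ Pol, LipschitzWith Lπ π) (hDyn : ∀ g ∈ Dyn, LipschitzWith Lf g)
    (hfD : f ∈ Dyn) (hopt : IsOptimalPolicy c T x₀ f Pol πstar xstar) (hβm : Monotone β)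
    (hβ0 : ∀ n, 0 ≤ β n) (hR : R.IsOCoRL k σ f noise β c T x₀ Pol Dyn)
    (hω : ∀ n, f ∈ R.confidenceSet k σ f noise β n ω) {a : ℝ} (ha : 0 ≤ a) (ha3 : a ≤ 3)
    (hsel : ∀ n, ∃ i < R.count (n + 1), ∀ t ∈ Icc 0 T,
      ‖R.std k σ n ω (R.stateAction (n + 1) ω t)‖ ≤
        a * ‖R.std k σ n ω (R.point (n + 1) i ω)‖) (N : ℕ) :
    R.regret c T πstar xstar N ω ≤
      6 * Lc * (1 + Lπ) * √(2 * dx * (σ ^ 2 + κ)) *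
        (β N * T ^ 2 * Real.exp (Lf * (1 + Lπ) * T) * √(N * maxInfoGain k σ N)) := by
  have h := hR.regret_le hk hσ hκ hT hc hPol hDyn hfD hopt hβm hβ0 hω ha (e := 0)
    (fun _ => le_rfl) (fun n => ?_) N
  · refine h.trans ?_
    have hG := gronwallBound_zero_le_mul_exp (L := Lf * (1 + Lπ)) (by positivity) T
    have hG0 : 0 ≤ gronwallBound 0 (Lf * (1 + Lπ)) 1 T :=
      gronwallBound_zero_nonneg (by positivity) hT.le
    have hβN := hβ0 N
    simp only [Pi.zero_apply, Finset.sum_const_zero, add_zero]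
    calc _ ≤ 2 * Lc * (1 + Lπ) * β N * T * (T * Real.exp (Lf * (1 + Lπ) * T)) *
        (3 * (√(2 * dx * (σ ^ 2 + κ)) * √(N * maxInfoGain k σ N))) := by gcongr
      _ = _ := by ring
  · obtain ⟨i, hi, hb⟩ := hsel n
    refine ⟨i, hi, fun t ht => ?_⟩
    obtain ⟨⟨-, ⟨hconf, -⟩, -⟩, -⟩ := hR.plausible hopt hfD (hω n)
    refine (norm_sub_le_of_mem_confidenceSet (hβ0 n) (hω n) hconf _).trans ?_
    rw [Pi.zero_apply, add_zero]
    exact mul_le_mul_of_nonneg_left (hb t ht) (mul_nonneg zero_le_two (hβ0 n))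

theorem sum_one_div_le_one_add_log (N : ℕ) :
    ∑ n ∈ Finset.range N, 1 / ((n : ℝ) + 1) ≤ 1 + Real.log N := by
  have h := harmonic_le_one_add_log N
  rw [harmonic] at h
  push_cast at h
  simpa using h

/-- The discretization errors sum to a multiple of 1 + log N. Here log N ≤ √(N log N), while the 1
is absorbed through `hK`. -/
theorem IsOCoRL.regret_le_of_equidistant (hk : ∀ z w, k z w = inner ℝ (φ z) (φ w)) (hσ : 0 < σ)
    (hκ : ∀ z, k z z ≤ κ) (hT : 0 < T) (hc : LipschitzWith Lc c)
    (hPol : ∀ π ∈ Pol, LipschitzWith Lπ π) (hDyn : ∀ g ∈ Dyn, LipschitzWith Lf g)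
    (hfD : f ∈ Dyn) (hopt : IsOptimalPolicy c T x₀ f Pol πstar xstar) (hβm : Monotone β)
    (hβ0 : ∀ n, 0 ≤ β n) (hR : R.IsOCoRL k σ f noise β c T x₀ Pol Dyn)
    (hω : ∀ n, f ∈ R.confidenceSet k σ f noise β n ω)
    (hstd : ∀ n, LipschitzWith Lσ (R.std k σ n ω)) (heq : R.IsEquidistant T)
    {F K : ℝ} (hF : ∀ z, ‖f z‖ ≤ F) (hK0 : 0 ≤ K)
    (hK : ∀ N, 1 ≤ N → F ≤ F * (K * √(maxInfoGain k σ N))) (N : ℕ) :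
    R.regret c T πstar xstar N ω ≤
      2 * Lc * (1 + Lπ) * (√(2 * dx * (σ ^ 2 + κ)) +
        Lσ * (1 + Lπ) * F / (Lf * (1 + Lπ)) * (K + 1)) *
        (β N * T ^ 2 * Real.exp (Lf * (1 + Lπ) * T) *
          √(N * (maxInfoGain k σ N + Real.log N))) := by
  rcases Nat.eq_zero_or_pos N with rfl | hN
  · simp [regret]
  have z₀ := R.stateAction 0 ω 0
  have hF0 : 0 ≤ F := (norm_nonneg _).trans (hF z₀)
  have hN' : (1 : ℝ) ≤ N := by exact_mod_cast hN
  have hlog : 0 ≤ Real.log N := Real.log_nonneg hN'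
  have hγ : 0 ≤ maxInfoGain k σ N := by
    refine le_trans ?_ (half_log_le_maxInfoGain hk hσ hκ z₀ hN)
    have h1 : 0 ≤ k z₀ z₀ := by rw [hk]; exact real_inner_self_nonneg
    have h2 : 0 ≤ k z₀ z₀ / σ ^ 2 := by positivity
    have := Real.log_nonneg (x := 1 + k z₀ z₀ / σ ^ 2) (by linarith)
    positivity
  set S := √(N * (maxInfoGain k σ N + Real.log N)) with hS
  have hS1 : √(N * maxInfoGain k σ N) ≤ S := Real.sqrt_le_sqrt (by gcongr; linarith)
  have hS2 : √(maxInfoGain k σ N) ≤ S := Real.sqrt_le_sqrt (by nlinarith)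
  have hS3 : Real.log N ≤ S := by
    apply Real.le_sqrt_of_sq_le
    have : Real.log N ≤ N := (Real.log_le_sub_one_of_pos (by positivity)).trans (by linarith)
    nlinarith
  -- The factor F is kept on both sides because γ_N may vanish; `hK` then holds with F = 0.
  have hFS : F * (1 + Real.log N) ≤ F * ((K + 1) * S) := by
    have h1 : F * (K * √(maxInfoGain k σ N)) ≤ F * (K * S) := by gcongr
    have h2 : F * Real.log N ≤ F * S := by gcongr
    have h3 := hK N hN
    linarith
  have hβN := hβ0 N
  have hG0 : 0 ≤ gronwallBound 0 (Lf * (1 + Lπ)) 1 T :=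
    gronwallBound_zero_nonneg (by positivity) hT.le
  have hG1 := gronwallBound_zero_le_mul_exp (L := Lf * (1 + Lπ)) (by positivity) T
  -- The 1/L form of Grönwall fails at Lf = 0. There all candidate dynamics are constant, so any
  -- measured point gives the exact mismatch bound with no discretization error, in agreement with
  -- the second term of the constant, which is 0 by division by zero.
  rcases eq_or_ne Lf 0 with rfl | hLf
  · have h := hR.regret_le hk hσ hκ hT hc hPol hDyn hfD hopt hβm hβ0 hω zero_le_one (e := 0)
      (fun _ => le_rfl) (fun n => ?_) N
    · refine h.trans ?_
      simp only [Pi.zero_apply, Finset.sum_const_zero, add_zero, one_mul, NNReal.coe_zero,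
        zero_mul, div_zero, Real.exp_zero, mul_one] at hG1 hG0 ⊢
      calc _ ≤ 2 * Lc * (1 + Lπ) * β N * T * T * (√(2 * dx * (σ ^ 2 + κ)) * S) := by gcongr
        _ = _ := by ring
    · have hpos : 0 < R.count (n + 1) := by
        obtain ⟨τ, hτ⟩ := heq
        rw [(hτ n).1]
        omega
      refine ⟨0, hpos, fun t _ => ?_⟩
      obtain ⟨⟨-, ⟨hconf, hmod⟩, -⟩, -⟩ := hR.plausible hopt hfD (hω n)
      have hconst : ∀ g ∈ Dyn, g (R.stateAction (n + 1) ω t) = g (R.point (n + 1) 0 ω) := by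
        intro g hg
        have := (hDyn g hg).dist_le_mul (R.stateAction (n + 1) ω t) (R.point (n + 1) 0 ω)
        rw [NNReal.coe_zero, zero_mul] at this
        exact dist_le_zero.1 this
      rw [hconst f hfD, hconst _ hmod, Pi.zero_apply, add_zero, one_mul]
      exact norm_sub_le_of_mem_confidenceSet (hβ0 n) (hω n) hconf _
  · have hL : 0 < (Lf : ℝ) * (1 + Lπ) := by positivity
    have hG2 := gronwallBound_zero_le_exp_div (t := T) hL
    set D := Lσ * (1 + Lπ) * F with hD
    have h := hR.regret_le hk hσ hκ hT hc hPol hDyn hfD hopt hβm hβ0 hω zero_le_one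
      (e := fun n => D * T * (1 / ((n : ℝ) + 1)))
      (fun n => by positivity) (fun n => ?_) N
    · refine h.trans ?_
      rw [← Finset.mul_sum]
      set G := gronwallBound 0 (Lf * (1 + Lπ)) 1 T
      set Q := √(2 * dx * (σ ^ 2 + κ))
      have hsum : D * T * ∑ n ∈ Finset.range N, 1 / ((n : ℝ) + 1) ≤ D * T * ((K + 1) * S) := by
        calc D * T * ∑ n ∈ Finset.range N, 1 / ((n : ℝ) + 1)
            ≤ D * T * (1 + Real.log N) := by
              gcongr
              exact sum_one_div_le_one_add_log N
          _ = Lσ * (1 + Lπ) * T * (F * (1 + Real.log N)) := by rw [hD]; ring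
          _ ≤ Lσ * (1 + Lπ) * T * (F * ((K + 1) * S)) := by gcongr
          _ = _ := by rw [hD]; ring
      calc _ ≤ 2 * Lc * (1 + Lπ) * β N * T * G * (1 * (Q * S) + D * T * ((K + 1) * S)) := by
            gcongr
        _ = 2 * Lc * (1 + Lπ) * β N * T * (G * (Q * S) + G * (D * T * ((K + 1) * S))) := by ring
        _ ≤ 2 * Lc * (1 + Lπ) * β N * T * (T * Real.exp (Lf * (1 + Lπ) * T) * (Q * S) +
            Real.exp (Lf * (1 + Lπ) * T) / (Lf * (1 + Lπ)) * (D * T * ((K + 1) * S))) := by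
          gcongr
        _ = _ := by ring
    · obtain ⟨i, hi, hb⟩ := hR.norm_std_le_of_equidistant hT hPol hF (hstd n) heq
      refine ⟨i, hi, fun t ht => ?_⟩
      obtain ⟨⟨-, ⟨hconf, -⟩, -⟩, -⟩ := hR.plausible hopt hfD (hω n)
      refine (norm_sub_le_of_mem_confidenceSet (hβ0 n) (hω n) hconf _).trans ?_
      rw [one_mul]
      exact mul_le_mul_of_nonneg_left (hb t ht) (mul_nonneg zero_le_two (hβ0 n))

/-- By monotonicity of β the step sizes are bounded by a multiple of 1/β_1. The exponential in Γ is
thus bounded, and Γ_n(Δ_n) is at most a constant times β_n. -/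
theorem isBigO_count_of_adaptive (hT : 0 < T) (hβm : Monotone β) (hβ0 : ∀ n, 0 ≤ β n)
    (had : R.IsAdaptive k σ f noise β T Dyn Lf Lπ Lσ) :
    (fun n => (R.count n : ℝ)) =O[atTop] β := by
  obtain ⟨Δ, hΔ⟩ := had
  -- The equation Δ · 2Γ(Δ) = 1 excludes Γ = 0, which makes both β_{n+1} and Lσ positive.
  have hβpos : ∀ n, 0 < β (n + 1) := fun n => by
    refine lt_of_le_of_ne (hβ0 _) fun h => ?_
    have := (hΔ n).2.1
    simp [Gam, ← h] at this
  have hLσ : 0 < (Lσ : ℝ) := by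
    refine lt_of_le_of_ne Lσ.2 fun h => ?_
    have := (hΔ 0).2.1
    simp [Gam, ← h] at this
  have hβ1 := hβpos 0
  set D := 1 / (4 * β (0 + 1) * Lσ * (1 + Lπ)) with hD
  have hbd : ∀ n, Δ (n + 1) ≤ D := by
    intro n
    obtain ⟨h0, h1, -⟩ := hΔ n
    have h2 : β (0 + 1) ≤ β (n + 1) := hβm (by omega)
    have h3 : 1 ≤ Real.exp (Lf * (1 + Lπ) * Δ (n + 1)) := Real.one_le_exp (by positivity)
    rw [hD, le_div_iff₀ (by positivity)]
    calc Δ (n + 1) * (4 * β (0 + 1) * Lσ * (1 + Lπ))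
        ≤ Δ (n + 1) * (4 * β (n + 1) * Lσ * (1 + Lπ)) := by gcongr
      _ = Δ (n + 1) * (4 * β (n + 1) * Lσ * (1 + Lπ)) * 1 := (mul_one _).symm
      _ ≤ Δ (n + 1) * (4 * β (n + 1) * Lσ * (1 + Lπ)) *
          Real.exp (Lf * (1 + Lπ) * Δ (n + 1)) := by
        have := hβ0 (n + 1)
        gcongr
      _ = Δ (n + 1) * (2 * Gam Lf Lπ Lσ (β (n + 1)) (Δ (n + 1))) := by rw [Gam]; ring
      _ = 1 := h1
  refine Asymptotics.IsBigO.of_bound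
    (4 * T * Lσ * (1 + Lπ) * Real.exp (Lf * (1 + Lπ) * D) + 1 / β (0 + 1)) ?_
  filter_upwards [eventually_ge_atTop 1] with m hm
  obtain ⟨n, rfl⟩ : ∃ n, m = n + 1 := ⟨m - 1, by omega⟩
  obtain ⟨h0, h1, h2, -⟩ := hΔ n
  have hβn := hβpos n
  have h3 : β (0 + 1) ≤ β (n + 1) := hβm (by omega)
  rw [Real.norm_of_nonneg (Nat.cast_nonneg _), Real.norm_of_nonneg hβn.le, h2]
  have h4 : T / Δ (n + 1) = T * (2 * Gam Lf Lπ Lσ (β (n + 1)) (Δ (n + 1))) := by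
    rw [div_eq_iff h0.ne', mul_assoc, mul_comm _ (Δ (n + 1)), h1, mul_one]
  -- Absorbs the 1 lost to the ceiling.
  have h5 : 1 ≤ 1 / β (0 + 1) * β (n + 1) := by
    rw [div_mul_eq_mul_div, one_mul, le_div_iff₀ hβ1]
    linarith
  have h6 : T * (2 * Gam Lf Lπ Lσ (β (n + 1)) (Δ (n + 1))) ≤
      4 * T * Lσ * (1 + Lπ) * Real.exp (Lf * (1 + Lπ) * D) * β (n + 1) := by
    calc _ = 4 * T * Lσ * (1 + Lπ) * Real.exp (Lf * (1 + Lπ) * Δ (n + 1)) * β (n + 1) := by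
          rw [Gam]; ring
      _ ≤ _ := by
        have := hbd n
        gcongr
  have h7 := (Nat.ceil_lt_add_one (a := T / Δ (n + 1)) (by positivity)).le
  rw [add_mul]
  linarith

end Selection

/-- Dynamics in the RKHS ball are bounded, by a constant that vanishes if the kernel does and can
be absorbed into the information gain otherwise. -/
theorem exists_norm_bound_of_inRKHSBall {Z H : Type*} [NormedAddCommGroup H]
    [InnerProductSpace ℝ H] [CompleteSpace H] [RKHS ℝ H Z ℝ] {k : Z → Z → ℝ}
    (hk : k = scalarKernel H) {κ : ℝ} (hκ : ∀ z, k z z ≤ κ) {σ : ℝ} (hσ : 0 < σ) (d : ℕ) (B : ℝ) :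
    ∃ F K : ℝ, 0 ≤ K ∧ (∀ N, 1 ≤ N → F ≤ F * (K * √(maxInfoGain k σ N))) ∧
      ∀ f : Z → Vec d, InRKHSBall H B f → ∀ z, ‖f z‖ ≤ F := by
  have hk' : ∀ z w, k z w =
      inner ℝ (RKHS.kerFun H z (1 : ℝ)) (RKHS.kerFun H w (1 : ℝ)) := fun z w => by
    rw [hk, scalarKernel_eq_inner]
  have hbound : ∀ f : Z → Vec d, InRKHSBall H B f → ∀ z, ‖f z‖ ≤ √(d * (B ^ 2 * k z z)) := by
    intro f hf z
    rw [EuclideanSpace.norm_eq]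
    apply Real.sqrt_le_sqrt
    calc ∑ j, ‖f z j‖ ^ 2 ≤ ∑ _j : Fin d, B ^ 2 * k z z := by
          refine Finset.sum_le_sum fun j _ => ?_
          obtain ⟨h, hB, hh⟩ := hf j
          rw [hh, apply_eq_inner_kerFun, hk', real_inner_self_eq_norm_sq, ← mul_pow]
          refine pow_le_pow_left₀ (norm_nonneg _) ?_ 2
          exact (norm_inner_le_norm _ _).trans (by gcongr)
      _ = d * (B ^ 2 * k z z) := by simp
  by_cases hz : ∃ z, 0 < k z z
  · obtain ⟨z₀, hz₀⟩ := hz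
    have hg : 0 < (1 / 2) * Real.log (1 + k z₀ z₀ / σ ^ 2) := by
      have h1 : 0 < k z₀ z₀ / σ ^ 2 := by positivity
      have := Real.log_pos (x := 1 + k z₀ z₀ / σ ^ 2) (by linarith)
      positivity
    set g := (1 / 2) * Real.log (1 + k z₀ z₀ / σ ^ 2)
    refine ⟨√(d * (B ^ 2 * κ)), 1 / √g, by positivity, fun N hN => ?_, fun f hf z => ?_⟩
    · refine le_mul_of_one_le_right (Real.sqrt_nonneg _) ?_
      rw [div_mul_eq_mul_div, one_mul, one_le_div (Real.sqrt_pos.2 hg)]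
      exact Real.sqrt_le_sqrt (half_log_le_maxInfoGain hk' hσ hκ z₀ hN)
    · refine (hbound f hf z).trans (Real.sqrt_le_sqrt ?_)
      have := hκ z
      gcongr
  · push Not at hz
    refine ⟨0, 0, le_rfl, by simp, fun f hf z => ?_⟩
    refine (hbound f hf z).trans_eq (Real.sqrt_eq_zero_of_nonpos ?_)
    exact mul_nonpos_of_nonneg_of_nonpos (by positivity)
      (mul_nonpos_of_nonneg_of_nonpos (by positivity) (hz z))

end Episodes

end OCoRL
end

/-! ### Assembly -/

open OCoRL
theorem mainTheorem1 {dx du : ℕ} (X : Set (Vec dx)) (U : Set (Vec du))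
    (H : Type*) [NormedAddCommGroup H] [InnerProductSpace ℝ H] [CompleteSpace H]
    [RKHS ℝ H (StateAction X U) ℝ]
    (k : StateAction X U → StateAction X U → ℝ) (hk : k = scalarKernel H)
    (hk_meas : Measurable (Function.uncurry k))
    (hk_bdd : BddAbove (Set.range fun z => k z z))
    (σ : ℝ≥0) (hσ : 0 < σ) (Lc Lπ : ℝ≥0) :
    ∃ C₁ : ℝ, ∀ (B : ℝ) (Lf Lσ : ℝ≥0), ∃ C₂ : ℝ,
    ∀ (T : ℝ) (_ : 0 < T) (x₀ : X)
      (c : StateAction X U → ℝ) (_ : LipschitzWith Lc c)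
      (Pol : Set (X → U)) (_ : ∀ π ∈ Pol, LipschitzWith Lπ π)
      (Dyn : Set (StateAction X U → Vec dx)) (_ : ∀ g ∈ Dyn, LipschitzWith Lf g)
      (f : StateAction X U → Vec dx) (_ : f ∈ Dyn) (_ : InRKHSBall H B f)
      (πstar : X → U) (xstar : ℝ → X) (_ : IsOptimalPolicy c T x₀ f Pol πstar xstar)
      (δ : ℝ) (_ : 0 < δ) (_ : δ ≤ 1)
      (β : ℕ → ℝ) (_ : Monotone β) (_ : ∀ n, 0 ≤ β n)
      (Ω : Type*) (_ : MeasurableSpace Ω) (P : Measure Ω) (_ : IsProbabilityMeasure P)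
      (noise : ℕ → ℕ → Fin dx → Ω → ℝ) (_ : IsGaussianNoise P σ noise)
      (R : Episodes X U Ω) (_ : R.IsOCoRL k σ f noise β c T x₀ Pol Dyn)
      (_ : ∀ n ω, LipschitzWith Lσ (R.std k σ n ω)),
      ((∀ n, B + √(2 * (maxInfoGain k σ (R.totalCount n) + Real.log (dx / δ))) ≤ β n) →
        R.WellCalibrated P k σ f noise β δ) ∧
      (R.WellCalibrated P k σ f noise β δ →
        (R.IsOracle k σ T →
          P {ω | ¬ ∀ N : ℕ, R.regret c T πstar xstar N ω ≤
            C₁ * (β N * T ^ 2 * Real.exp (Lf * (1 + Lπ) * T) *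
              √(N * maxInfoGain k σ N))} ≤ ENNReal.ofReal δ) ∧
        (R.IsEquidistant T →
          P {ω | ¬ ∀ N : ℕ, R.regret c T πstar xstar N ω ≤
            C₂ * (β N * T ^ 2 * Real.exp (Lf * (1 + Lπ) * T) *
              √(N * (maxInfoGain k σ N + Real.log N)))} ≤ ENNReal.ofReal δ) ∧
        (R.IsAdaptive k σ f noise β T Dyn Lf Lπ Lσ →
          P {ω | ¬ ∀ N : ℕ, R.regret c T πstar xstar N ω ≤
            C₁ * (β N * T ^ 2 * Real.exp (Lf * (1 + Lπ) * T) *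
              √(N * maxInfoGain k σ N))} ≤ ENNReal.ofReal δ)) ∧
      (R.IsAdaptive k σ f noise β T Dyn Lf Lπ Lσ →
        (fun n => (R.count n : ℝ)) =O[atTop] β) := by
  obtain ⟨κ, hκ'⟩ := hk_bdd
  have hκ : ∀ z, k z z ≤ κ := fun z => hκ' ⟨z, rfl⟩
  have hσ' : (0 : ℝ) < σ := hσ
  have hinner : ∀ z w, k z w =
      inner ℝ (RKHS.kerFun H z (1 : ℝ)) (RKHS.kerFun H w (1 : ℝ)) := fun z w => by
    rw [hk, scalarKernel_eq_inner]
  refine ⟨6 * Lc * (1 + Lπ) * √(2 * dx * ((σ : ℝ) ^ 2 + κ)), fun B Lf Lσ => ?_⟩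
  obtain ⟨F, K, hK0, hK, hF⟩ :=
    Episodes.exists_norm_bound_of_inRKHSBall (H := H) hk hκ hσ' dx B
  refine ⟨2 * Lc * (1 + Lπ) * (√(2 * dx * ((σ : ℝ) ^ 2 + κ)) +
    Lσ * (1 + Lπ) * F / (Lf * (1 + Lπ)) * (K + 1)), ?_⟩
  intro T hT x₀ c hc Pol hPol Dyn hDyn f hfD hfB πstar xstar hopt δ hδ _ β hβm hβ0 Ω _ P _ noise
    hnoise R hR hstd
  -- The regret bounds hold pointwise on the calibration event, so no further probability is lost;
  -- monotonicity of the measure needs no measurability of `Q`.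
  have hcal_le : ∀ Q : Ω → Prop, R.WellCalibrated P k σ f noise β δ →
      (∀ ω, (∀ n, f ∈ R.confidenceSet k σ f noise β n ω) → Q ω) →
      P {ω | ¬ Q ω} ≤ ENNReal.ofReal δ := by
    intro Q hcal hQ
    refine (measure_mono ?_).trans hcal
    intro ω hω hcon
    exact hω (hQ ω hcon)
  refine ⟨fun hβ => Episodes.wellCalibrated hk hk_meas hκ hσ hfB hδ hnoise hR.measurable_point hβ,
    fun hcal => ⟨fun hor => ?_, fun heq => ?_, fun had => ?_⟩,
    fun had => Episodes.isBigO_count_of_adaptive hT hβm hβ0 had⟩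
  · refine hcal_le _ hcal fun ω hcon N => ?_
    refine hR.regret_le_of_norm_std_le hinner hσ' hκ hT hc hPol hDyn hfD hopt hβm hβ0 hcon
      zero_le_one (by norm_num) (fun n => ?_) N
    obtain ⟨hcount, hmax⟩ := hor n
    refine ⟨0, by omega, fun t ht => ?_⟩
    rw [one_mul]
    exact hmax ω ht
  · refine hcal_le _ hcal fun ω hcon N => ?_
    exact hR.regret_le_of_equidistant hinner hσ' hκ hT hc hPol hDyn hfD hopt hβm hβ0 hcon
      (fun n => hstd n ω) heq (hF f hfB) hK0 hK N
  · refine hcal_le _ hcal fun ω hcon N => ?_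
    exact hR.regret_le_of_norm_std_le hinner hσ' hκ hT hc hPol hDyn hfD hopt hβm hβ0 hcon
      zero_le_three le_rfl (fun n => hR.norm_std_le_of_adaptive hT hPol hDyn hfD hopt hβm hβ0
        (hcon n) (hstd n ω) had) N
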